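/- **Theorem (classification scheme for nilpotent symplectic Lie algebras).** *Symplectic Lie algebras.* A symplectic Lie algebra $(\mathfrak g,\omega)$ is a finite-dimensional real Lie algebra with a skew-symmetric non-degenerate bilinear form $\omega$ such that $\omega([X,Y],Z)+\omega([Y,Z],X)+\omega([Z,X],Y)=0$ for all $X,Y,Z$. An isomorphism $(\mathfrak g_1,\omega_1)\to(\mathfrak g_2,\omega_2)$ is a Lie algebra isomorphism $\varphi$ with $\varphi^*\omega_2=\omega_1$. *Cocycles.* Let $(\mathfrak a,\omega_{\mathfrak a})$ be a symplectic Lie algebra and $\mathfrak l$ a finite-dimensional real vector space (abelian Lie algebra) with dual $\mathfrak l^*$. Consider triples $(\gamma,\epsilon,\xi)$ of linear maps $\gamma:\mathfrak l\to\operatorname{Hom}(\mathfrak a,\mathfrak l^*)$, $\xi:\mathfrak l\to\operatorname{Hom}(\mathfrak a)$ and an alternating bilinear map $\epsilon:\mathfrak l\times\mathfrak l\to\mathfrak l^*$. For such a triple put $$\beta(A_1,A_2)(L)=-\omega_{\mathfrak a}(\xi(L)A_1,A_2)-\omega_{\mathfrak a}(A_1,\xi(L)A_2)$$ and let $\alpha:\mathfrak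 l\times\mathfrak l\to\mathfrak a$ be determined by $\omega_{\mathfrak a}(\alpha(L_1,L_2),A)=(\gamma(L_1)A)(L_2)-(\gamma(L_2)A)(L_1)$. The triple is a *quadratic cocycle* if for all arguments 1. $\xi(L)$ is a derivation of $\mathfrak a$, $[\xi(L_1),\xi(L_2)]=\operatorname{ad}_{\mathfrak a}(\alpha(L_1,L_2))$, and $\xi(L_1)\alpha(L_2,L_3)-\xi(L_2)\alpha(L_1,L_3)+\xi(L_3)\alpha(L_1,L_2)=0$; 2. $\beta(\xi(L)A_1,A_2)+\beta(A_1,\xi(L)A_2)=\gamma(L)[A_1,A_2]$; 3. $\gamma(L_2)\circ\xi(L_1)-\gamma(L_1)\circ\xi(L_2)+\beta(\alpha(L_1,L_2),\cdot)=0$; 4. $\gamma(L_1)\alpha(L_2,L_3)-\gamma(L_2)\alpha(L_1,L_3)+\gamma(L_3)\alpha(L_1,L_2)=0$; 5. $\epsilon(L_1,L_2)(L_3)+\epsilon(L_2,L_3)(L_1)+\epsilon(L_3,L_1)(L_2)=0$. It is *balanced* if moreover * (a) whenever $L\in\mathfrak l$ and $A\in\mathfrak a$ satisfy $\operatorname{ad}_{\mathfrak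 a}(A)+\xi(L)=0$, $\gamma(L)+\beta(A,\cdot)=0$, $\alpha(L,L')=\xi(L')A$ and $\epsilon(L,L')=\gamma(L')A$ for all $L'\in\mathfrak l$, then $L=0$; * (b) $\omega_{\mathfrak a}$ is non-degenerate on the subspace of all $A\in\mathfrak z(\mathfrak a)$ with $\beta(A,\cdot)=0$, and $\xi(L)A=0$, $\gamma(L)A=0$ for all $L\in\mathfrak l$. It is *nilpotent* if it is balanced and there is $N\in\mathbb N$ with $\xi(L_1)\cdots\xi(L_N)=0$ for all $L_1,\dots,L_N\in\mathfrak l$. *Standard model.* For a quadratic cocycle, $\mathfrak d_{\gamma,\epsilon,\xi}(\mathfrak l,\mathfrak a)$ is the symplectic Lie algebra $\mathfrak l^*\oplus\mathfrak a\oplus\mathfrak l$ in which $\mathfrak l^*$ is central, $[A_1,A_2]=\beta(A_1,A_2)+[A_1,A_2]_{\mathfrak a}$, $[L,A]=\gamma(L)A+\xi(L)A$, $[L_1,L_2]=\epsilon(L_1,L_2)+\alpha(L_1,L_2)$, with symplectic form $\omega(Z_1+A_1+L_1,Z_2+A_2+L_2)=Z_1(L_2)+\omega_{\mathfrak a}(A_1,A_2)-Z_2(L_1)$.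 *Cohomology.* For linear $\tau:\mathfrak l\to\mathfrak a$ put $(\tau^*A)(L)=\omega_{\mathfrak a}(\tau L,A)$. The group $\operatorname{Hom}(\mathfrak l,\mathfrak a)$ acts on triples by $(\gamma,\epsilon,\xi)\tau=(\gamma',\epsilon',\xi')$, where $\xi'(L)A=\xi(L)A-[\tau L,A]$, $\gamma'(L)A=\gamma(L)A+\tau^*(\xi(L)A)-\tau^*[\tau L,A]-\beta(\tau L,A)$ and $$\epsilon'(L,M)=\epsilon(L,M)+\tau^*\alpha(L,M)-\gamma(L)\tau M+\gamma(M)\tau L-\tau^*(\xi(L)\tau M-\xi(M)\tau L)+\beta(\tau L,\tau M)+\tau^*[\tau L,\tau M].$$ Let $[\gamma,\epsilon,\xi]$ be the orbit of a triple and $H^2(\mathfrak l,\mathfrak a,\omega_{\mathfrak a})_0$ the set of orbits of nilpotent cocycles. The group $G$ of pairs $(S,U)$ of a linear automorphism $S$ of $\mathfrak l$ and an automorphism $U$ of $(\mathfrak a,\omega_{\mathfrak a})$ acts on it by pull back, $(S,U)^*[\gamma,\epsilon,\xi]=[\gamma',\epsilon',\xi']$ with $\gamma'(L)A=\gamma(SL)(U^{-1}A)\circ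 S$, $\epsilon'(L,M)=\epsilon(SL,SM)\circ S$, $\xi'(L)A=U\,\xi(SL)\,U^{-1}A$. *Statement.* Let $n\ge 0$, and for $1\le m\le n$ let $\mathfrak A(2n-2m)$ be a system of representatives of the isomorphism classes of $(2n-2m)$-dimensional nilpotent symplectic Lie algebras. Then $$[\gamma,\epsilon,\xi]\cdot G\;\longmapsto\;\text{isomorphism class of }\mathfrak d_{\gamma,\epsilon,\xi}(\mathbb R^m,\mathfrak a)$$ for nilpotent cocycles $(\gamma,\epsilon,\xi)$ is a well-defined bijection from $$\coprod_{m=1}^n\ \coprod_{(\mathfrak a,\omega_{\mathfrak a})\in\mathfrak A(2n-2m)}H^2(\mathbb R^m,\mathfrak a,\omega_{\mathfrak a})_0/G$$ onto the set of isomorphism classes of non-abelian nilpotent $2n$-dimensional symplectic Lie algebras. -/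

import Mathlib

universe u v

open Module

namespace SymplecticLie

noncomputable section

/-! ### Symplectic Lie algebras and their isomorphism classes -/

/-- A (finite-dimensional, real) symplectic Lie algebra: a real Lie algebra with a skew-symmetric
non-degenerate closed bilinear form. -/
structure SymplecticLieAlgebra where
  carrier : Type u
  [lieRing : LieRing carrier]
  [lieAlgebra : LieAlgebra ℝ carrier]
  [finiteDimensional : FiniteDimensional ℝ carrier]
  form : LinearMap.BilinForm ℝ carrier
  isAlt : form.IsAlt
  nondegenerate : form.Nondegenerate
  closed : ∀ X Y Z : carrier, -form ⁅X, Y⁆ Z + form ⁅X, Z⁆ Y - form ⁅Y, Z⁆ X = 0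

instance : CoeSort SymplecticLieAlgebra.{u} (Type u) := ⟨SymplecticLieAlgebra.carrier⟩

instance (g : SymplecticLieAlgebra.{u}) : LieRing g := g.lieRing
instance (g : SymplecticLieAlgebra.{u}) : LieAlgebra ℝ g := g.lieAlgebra
instance (g : SymplecticLieAlgebra.{u}) : FiniteDimensional ℝ g := g.finiteDimensional

/-- Isomorphisms of symplectic Lie algebras: Lie algebra isomorphisms `φ` with `φ^* ω_h = ω_g`. -/
structure SymplecticIso (g h : SymplecticLieAlgebra.{u}) where
  toLieEquiv : g ≃ₗ⁅ℝ⁆ h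
  map_form : ∀ X Y : g, h.form (toLieEquiv X) (toLieEquiv Y) = g.form X Y

namespace SymplecticIso

variable {g h k : SymplecticLieAlgebra.{u}}

def refl (g : SymplecticLieAlgebra.{u}) : SymplecticIso g g := ⟨LieEquiv.refl, fun _ _ => rfl⟩

def symm (φ : SymplecticIso g h) : SymplecticIso h g :=
  ⟨φ.toLieEquiv.symm, fun X Y => by rw [← φ.map_form]; simp⟩

def trans (φ : SymplecticIso g h) (ψ : SymplecticIso h k) : SymplecticIso g k :=
  ⟨φ.toLieEquiv.trans ψ.toLieEquiv, fun X Y => by simp [φ.map_form, ψ.map_form]⟩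

end SymplecticIso

instance isoSetoid : Setoid SymplecticLieAlgebra.{u} where
  r g h := Nonempty (SymplecticIso g h)
  iseqv := ⟨fun g => ⟨.refl g⟩, fun ⟨φ⟩ => ⟨φ.symm⟩, fun ⟨φ⟩ ⟨ψ⟩ => ⟨φ.trans ψ⟩⟩

/-- Isomorphism classes of symplectic Lie algebras. -/
abbrev IsoClass : Type (u + 1) := Quotient isoSetoid.{u}

/-- The set of isomorphism classes of non-abelian nilpotent `d`-dimensional symplectic Lie
algebras. -/
def nonabelianNilpotentClasses (d : ℕ) : Set IsoClass.{u} :=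
  {c | ∃ g : SymplecticLieAlgebra.{u}, ¬ IsLieAbelian g ∧ LieRing.IsNilpotent g ∧
    finrank ℝ g = d ∧ c = ⟦g⟧}

/-- `R` is a system of representatives of the isomorphism classes of `d`-dimensional nilpotent
symplectic Lie algebras. -/
structure IsNilpotentRepresentatives (d : ℕ) (R : Set SymplecticLieAlgebra.{u}) : Prop where
  isNilpotent : ∀ a ∈ R, LieRing.IsNilpotent a
  finrank_eq : ∀ a ∈ R, finrank ℝ a = d
  existsUnique : ∀ g : SymplecticLieAlgebra.{u}, LieRing.IsNilpotent g → finrank ℝ g = d →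
    ∃! a, a ∈ R ∧ Nonempty (SymplecticIso g a)

/-! ### Triples `(γ, ε, ξ)`

Here `l` is an abelian Lie algebra, i.e. just a real vector space, with dual `l^* = Dual ℝ l`. -/

section Dualization

variable {l : Type v} [AddCommGroup l] [Module ℝ l] {a : SymplecticLieAlgebra.{u}}

/-- The dual map `f^* : l → a` of `f : a → l^*`, determined by `(f A) L = ω_a (f^* L, A)`. -/
def dualMap (f : a →ₗ[ℝ] Dual ℝ l) : l →ₗ[ℝ] a :=
  (a.form.toDual a.nondegenerate).symm.toLinearMap ∘ₗ f.flip

/-- The dual map `τ^* : a → l^*` of `τ : l → a`, given by `(τ^* A) L = ω_a (τ L, A)`. -/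
def starMap (τ : l →ₗ[ℝ] a) : a →ₗ[ℝ] Dual ℝ l :=
  (a.form ∘ₗ τ).flip

theorem form_dualMap (f : a →ₗ[ℝ] Dual ℝ l) (L : l) (A : a) :
    a.form (dualMap f L) A = f A L := by
  simp [dualMap, LinearMap.BilinForm.apply_toDual_symm_apply]

@[simp] theorem starMap_apply (τ : l →ₗ[ℝ] a) (A : a) (L : l) :
    starMap τ A L = a.form (τ L) A := rfl

end Dualization

/-- Triples of linear maps `γ : l → Hom(a, l^*)`, `ξ : l → Hom(a)` and a `2`-form `ε` on `l` with
values in `l^*`. -/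
@[ext] structure Triple (l : Type v) [AddCommGroup l] [Module ℝ l]
    (a : SymplecticLieAlgebra.{u}) where
  γ : l →ₗ[ℝ] a →ₗ[ℝ] Dual ℝ l
  ε : l →ₗ[ℝ] l →ₗ[ℝ] Dual ℝ l
  ε_alt : ∀ L, ε L L = 0
  ξ : l →ₗ[ℝ] End ℝ a

namespace Triple

variable {l : Type v} [AddCommGroup l] [Module ℝ l] {a : SymplecticLieAlgebra.{u}}

/-- `β (A₁, A₂) = - ω_a (ξ(·) A₁, A₂) - ω_a (A₁, ξ(·) A₂)`; as a linear map `a → Hom(a, l^*)`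
this is `β₀`. -/
def β (x : Triple l a) : a →ₗ[ℝ] a →ₗ[ℝ] Dual ℝ l :=
  LinearMap.mk₂ ℝ
    (fun A₁ A₂ => -((a.form.flip A₂) ∘ₗ x.ξ.flip A₁) - a.form A₁ ∘ₗ x.ξ.flip A₂)
    (fun A B C => by ext; simp; ring) (fun c A B => by ext; simp; ring)
    (fun A B C => by ext; simp; ring) (fun c A B => by ext; simp; ring)

theorem β_apply (x : Triple l a) (A₁ A₂ : a) (L : l) :
    x.β A₁ A₂ L = -a.form (x.ξ L A₁) A₂ - a.form A₁ (x.ξ L A₂) := rfl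

/-- `α (L₁, L₂) = (γ L₁)^* L₂ - (γ L₂)^* L₁`. -/
def α (x : Triple l a) : l →ₗ[ℝ] l →ₗ[ℝ] a :=
  LinearMap.mk₂ ℝ (fun L₁ L₂ => dualMap (x.γ L₁) L₂ - dualMap (x.γ L₂) L₁)
    (fun L M N => by
      simp only [map_add, dualMap, LinearMap.comp_apply, LinearEquiv.coe_coe]
      rw [show (x.γ L + x.γ M).flip N = (x.γ L).flip N + (x.γ M).flip N from rfl, map_add]
      abel)
    (fun c L M => by
      simp only [map_smul, dualMap, LinearMap.comp_apply, LinearEquiv.coe_coe, smul_sub]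
      rw [show (c • x.γ L).flip M = c • (x.γ L).flip M from rfl, map_smul])
    (fun L M N => by
      simp only [map_add, dualMap, LinearMap.comp_apply, LinearEquiv.coe_coe]
      rw [show (x.γ M + x.γ N).flip L = (x.γ M).flip L + (x.γ N).flip L from rfl, map_add]
      abel)
    (fun c L M => by
      simp only [map_smul, dualMap, LinearMap.comp_apply, LinearEquiv.coe_coe, smul_sub]
      rw [show (c • x.γ M).flip L = c • (x.γ M).flip L from rfl, map_smul])

theorem α_apply (x : Triple l a) (L₁ L₂ : l) :
    x.α L₁ L₂ = dualMap (x.γ L₁) L₂ - dualMap (x.γ L₂) L₁ := rfl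

theorem form_α (x : Triple l a) (L₁ L₂ : l) (A : a) :
    a.form (x.α L₁ L₂) A = x.γ L₁ A L₂ - x.γ L₂ A L₁ := by
  simp [α_apply, form_dualMap]

/-- The quadratic cocycles `Z²(l, a, ω_a)`. -/
structure IsCocycle (x : Triple l a) : Prop where
  -- `(ξ, α)` is a factor system (three conditions; `l` is abelian)
  derivation : ∀ L A B, x.ξ L ⁅A, B⁆ = ⁅x.ξ L A, B⁆ + ⁅A, x.ξ L B⁆
  curvature : ∀ L₁ L₂, x.ξ L₁ * x.ξ L₂ - x.ξ L₂ * x.ξ L₁ = LieAlgebra.ad ℝ a (x.α L₁ L₂)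
  dξ_α : ∀ L₁ L₂ L₃,
    x.ξ L₁ (x.α L₂ L₃) - x.ξ L₂ (x.α L₁ L₃) + x.ξ L₃ (x.α L₁ L₂) = 0
  β_ξ : ∀ L A₁ A₂, x.β (x.ξ L A₁) A₂ + x.β A₁ (x.ξ L A₂) = x.γ L ⁅A₁, A₂⁆
  -- `d_ξ̂ γ + β₀ ∘ α = 0`, where `ξ̂(L) f = f ∘ ξ(L)`
  dξ_γ : ∀ L₁ L₂, x.γ L₂ ∘ₗ x.ξ L₁ - x.γ L₁ ∘ₗ x.ξ L₂ + x.β (x.α L₁ L₂) = 0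
  -- `ev(γ ∧ α) = 0`
  γ_α : ∀ L₁ L₂ L₃,
    x.γ L₁ (x.α L₂ L₃) - x.γ L₂ (x.α L₁ L₃) + x.γ L₃ (x.α L₁ L₂) = 0
  ε_cyclic : ∀ L₁ L₂ L₃, x.ε L₁ L₂ L₃ + x.ε L₂ L₃ L₁ + x.ε L₃ L₁ L₂ = 0

/-- The subspace `z(a) ∩ ker β₀ ∩ ker ξ₀ ∩ ker γ₀` of `a`, where `ξ₀(A) L = ξ(L) A` and
`γ₀(A) L = γ(L) A`. -/
def centralPart (x : Triple l a) : Submodule ℝ a :=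
  (LieAlgebra.center ℝ a).toSubmodule ⊓ LinearMap.ker x.β ⊓ LinearMap.ker x.ξ.flip ⊓
    LinearMap.ker x.γ.flip

/-- The balanced quadratic cocycles. -/
structure IsBalanced (x : Triple l a) : Prop extends IsCocycle x where
  eq_zero : ∀ (L : l) (A : a), LieAlgebra.ad ℝ a A + x.ξ L = 0 → x.γ L + x.β A = 0 →
    x.α L = x.ξ.flip A → x.ε L = x.γ.flip A → L = 0
  nondegenerate : (a.form.restrict x.centralPart).Nondegenerate

/-- The nilpotent cocycles: balanced cocycles such that, for some `N`, every product
`ξ(L₁) ⋯ ξ(L_N)` vanishes. -/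
structure IsNilpotentCocycle (x : Triple l a) : Prop extends IsBalanced x where
  nilpotent : ∃ N : ℕ, ∀ Ls : List l, Ls.length = N → (Ls.map x.ξ).prod = 0

end Triple

/-! ### The standard model -/

namespace Triple

variable {l : Type v} [AddCommGroup l] [Module ℝ l] {a : SymplecticLieAlgebra.{u}}

/-- The bracket on `l^* ⊕ a ⊕ l`:
`[A₁, A₂] = β(A₁, A₂) + [A₁, A₂]_a`, `[L, A] = γ(L) A + ξ(L) A`,
`[L₁, L₂] = ε(L₁, L₂) + α(L₁, L₂)`, with `l^*` central. -/
def bracket (x : Triple l a) (X Y : Dual ℝ l × a × l) : Dual ℝ l × a × l :=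
  (x.β X.2.1 Y.2.1 + x.γ X.2.2 Y.2.1 - x.γ Y.2.2 X.2.1 + x.ε X.2.2 Y.2.2,
   ⁅X.2.1, Y.2.1⁆ + x.ξ X.2.2 Y.2.1 - x.ξ Y.2.2 X.2.1 + x.α X.2.2 Y.2.2,
   0)

end Triple

/-- The form `ω(Z₁ + A₁ + L₁, Z₂ + A₂ + L₂) = Z₁(L₂) + ω_a(A₁, A₂) - Z₂(L₁)` on
`l^* ⊕ a ⊕ l`. -/
def modelForm (l : Type v) [AddCommGroup l] [Module ℝ l] (a : SymplecticLieAlgebra.{u}) :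
    LinearMap.BilinForm ℝ (Dual ℝ l × a × l) :=
  LinearMap.mk₂ ℝ (fun X Y => X.1 Y.2.2 + a.form X.2.1 Y.2.1 - Y.1 X.2.2)
    (fun X Y Z => by simp; ring) (fun c X Y => by simp; ring)
    (fun X Y Z => by simp; ring) (fun c X Y => by simp; ring)

theorem modelForm_apply {l : Type v} [AddCommGroup l] [Module ℝ l]
    {a : SymplecticLieAlgebra.{u}} (X Y : Dual ℝ l × a × l) :
    modelForm l a X Y = X.1 Y.2.2 + a.form X.2.1 Y.2.1 - Y.1 X.2.2 := rfl

section StandardModel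

variable {l : Type v} [AddCommGroup l] [Module ℝ l] {a : SymplecticLieAlgebra.{u}}

theorem SymplecticLieAlgebra.form_swap (a : SymplecticLieAlgebra.{u}) (A B : a) :
    a.form A B = -a.form B A := by
  have h := a.isAlt (A + B)
  simp only [map_add, LinearMap.add_apply, a.isAlt A, a.isAlt B, zero_add, add_zero] at h
  linarith

theorem SymplecticLieAlgebra.form_cyclic (a : SymplecticLieAlgebra.{u}) (X Y Z : a) :
    a.form ⁅X, Y⁆ Z + a.form ⁅Y, Z⁆ X + a.form ⁅Z, X⁆ Y = 0 := by
  have h := a.closed X Y Z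
  rw [← lie_skew X Z, map_neg, LinearMap.neg_apply] at h
  linarith

namespace Triple

theorem β_self (x : Triple l a) (A : a) : x.β A A = 0 := by
  ext L
  rw [β_apply, a.form_swap A]
  simp

theorem β_swap (x : Triple l a) (A B : a) : x.β A B = -x.β B A := by
  ext L
  rw [LinearMap.neg_apply, β_apply, β_apply, a.form_swap A, a.form_swap _ B]
  ring

theorem α_self (x : Triple l a) (L : l) : x.α L L = 0 := by
  rw [α_apply, sub_self]

theorem α_swap (x : Triple l a) (L M : l) : x.α L M = -x.α M L := by
  rw [α_apply, α_apply, neg_sub]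

theorem ε_swap (x : Triple l a) (L M : l) : x.ε L M = -x.ε M L := by
  have h := x.ε_alt (L + M)
  simp only [map_add, LinearMap.add_apply, x.ε_alt, zero_add, add_zero] at h
  rw [add_comm] at h
  exact eq_neg_of_add_eq_zero_left h

theorem β_lie (x : Triple l a) (hx : x.IsCocycle) (A B C : a) :
    x.β A ⁅B, C⁆ = x.β ⁅A, B⁆ C + x.β B ⁅A, C⁆ := by
  ext L
  simp only [LinearMap.add_apply, β_apply, hx.derivation, map_add]
  have h1 := a.form_cyclic (x.ξ L A) B C
  have h2 := a.form_cyclic A (x.ξ L B) C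
  have h3 := a.form_cyclic A B (x.ξ L C)
  rw [← lie_skew C (x.ξ L A), map_neg, LinearMap.neg_apply, a.form_swap ⁅B, C⁆] at h1
  rw [← lie_skew C A, map_neg, LinearMap.neg_apply, a.form_swap _ A,
    a.form_swap _ (x.ξ L B)] at h2
  rw [← lie_skew (x.ξ L C) A, map_neg, LinearMap.neg_apply, a.form_swap _ A,
    a.form_swap _ B] at h3
  rw [a.form_swap ⁅x.ξ L A, C⁆ B] at h1
  linarith

theorem bracket_leibniz (x : Triple l a) (hx : x.IsCocycle) (X Y Z : Dual ℝ l × a × l) :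
    x.bracket X (x.bracket Y Z) = x.bracket (x.bracket X Y) Z + x.bracket Y (x.bracket X Z) := by
  obtain ⟨-, A, L⟩ := X
  obtain ⟨-, B, M⟩ := Y
  obtain ⟨-, C, N⟩ := Z
  have curv : ∀ L M A, x.ξ L (x.ξ M A) - x.ξ M (x.ξ L A) = ⁅x.α L M, A⁆ := fun L M A =>
    LinearMap.congr_fun (hx.curvature L M) A
  have dg : ∀ L M A, x.γ M (x.ξ L A) - x.γ L (x.ξ M A) + x.β (x.α L M) A = 0 := fun L M A =>
    LinearMap.congr_fun (hx.dξ_γ L M) A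
  simp only [bracket, Prod.mk_add_mk, map_zero, LinearMap.zero_apply, add_zero, sub_zero,
    map_add, map_sub, LinearMap.add_apply, LinearMap.sub_apply, lie_add, lie_sub,
    add_lie, sub_lie, hx.derivation]
  refine Prod.ext ?_ (Prod.ext ?_ rfl)
  · have h1 := x.β_lie hx A B C
    have h2 := hx.β_ξ L B C
    have h3 := hx.β_ξ M A C
    have h4 := hx.β_ξ N A B
    have h5 := dg L M C
    have h6 := dg M N A
    have h7 := dg L N B
    have h8 := hx.γ_α L M N
    rw [x.β_swap (x.α M N) A] at h6
    rw [x.β_swap (x.α L N) B] at h7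
    rw [x.β_swap (x.ξ N A) B] at h4
    dsimp only
    linear_combination (norm := module) h1 - h2 + h3 - h4 - h5 - h6 + h7 + h8
  · have h1 := leibniz_lie A B C
    have h5 := curv L M C
    have h6 := curv M N A
    have h7 := curv L N B
    have h8 := hx.dξ_α L M N
    rw [← lie_skew (x.α M N) A] at h6
    rw [← lie_skew (x.α L N) B] at h7
    dsimp only
    have h9 := lie_skew B (x.ξ N A)
    linear_combination (norm := module) h1 + h5 + h6 - h7 + h8 - h9

theorem bracket_closed (x : Triple l a) (hx : x.IsCocycle) (X Y Z : Dual ℝ l × a × l) :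
    -modelForm l a (x.bracket X Y) Z + modelForm l a (x.bracket X Z) Y
      - modelForm l a (x.bracket Y Z) X = 0 := by
  obtain ⟨-, A, L⟩ := X
  obtain ⟨-, B, M⟩ := Y
  obtain ⟨-, C, N⟩ := Z
  have h1 := a.closed A B C
  have h2 := hx.ε_cyclic L M N
  have h3 : x.ε L N M = -x.ε N L M := by rw [x.ε_swap L N]; rfl
  simp only [bracket, modelForm_apply, map_zero, map_add, map_sub, LinearMap.add_apply,
    LinearMap.sub_apply, sub_zero, form_α, β_apply]
  linarith [a.form_swap A (x.ξ N B), a.form_swap A (x.ξ M C), a.form_swap B (x.ξ L C),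
    a.form_swap B (x.ξ N A)]

end Triple

theorem modelForm_isAlt (l : Type v) [AddCommGroup l] [Module ℝ l]
    (a : SymplecticLieAlgebra.{u}) : (modelForm l a).IsAlt := by
  intro X
  rw [modelForm_apply, a.isAlt X.2.1]
  ring

theorem modelForm_nondegenerate (l : Type v) [AddCommGroup l] [Module ℝ l]
    (a : SymplecticLieAlgebra.{u}) : (modelForm l a).Nondegenerate := by
  have key : (modelForm l a).SeparatingLeft := by
    rintro ⟨Z, A, L⟩ h
    simp only [modelForm_apply] at h
    have h1 : Z = 0 := by
      ext M
      simpa using h (0, 0, M)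
    have h2 : A = 0 := a.nondegenerate.1 A fun B => by simpa using h (0, B, 0)
    have h3 : L = 0 := by
      rw [← Module.forall_dual_apply_eq_zero_iff ℝ]
      intro W
      simpa using h (W, 0, 0)
    rw [h1, h2, h3]
    rfl
  refine ⟨key, fun Y h => key Y fun X => ?_⟩
  rw [← (modelForm_isAlt l a).neg_eq, h X, neg_zero]

/-- The standard model `d_{γ,ε,ξ}(l, a)` of a quadratic cocycle: the vector space `l^* ⊕ a ⊕ l`
with the bracket and the form above. -/
def standardModel [FiniteDimensional ℝ l] (x : Triple l a) (hx : x.IsCocycle) :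
    SymplecticLieAlgebra.{max v u} :=
  letI ring : LieRing (Dual ℝ l × a × l) :=
    { bracket := x.bracket
      add_lie := fun X Y Z => by
        refine Prod.ext ?_ (Prod.ext ?_ (add_zero 0).symm) <;>
          simp [Triple.bracket] <;> abel
      lie_add := fun X Y Z => by
        refine Prod.ext ?_ (Prod.ext ?_ (add_zero 0).symm) <;>
          simp [Triple.bracket] <;> abel
      lie_self := fun X => by
        refine Prod.ext ?_ (Prod.ext ?_ rfl)
        · simp [Triple.bracket, x.β_self, x.ε_alt]
        · simp [Triple.bracket, x.α_self]
      leibniz_lie := x.bracket_leibniz hx }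
  letI alg : LieAlgebra ℝ (Dual ℝ l × a × l) :=
    { lie_smul := fun c X Y => by
        refine Prod.ext ?_ (Prod.ext ?_ (smul_zero c).symm)
        · change (x.bracket X (c • Y)).1 = c • (x.bracket X Y).1
          simp [Triple.bracket, smul_add, smul_sub]
        · change (x.bracket X (c • Y)).2.1 = c • (x.bracket X Y).2.1
          simp [Triple.bracket, smul_add, smul_sub] }
  { carrier := Dual ℝ l × a × l
    lieRing := ring
    lieAlgebra := alg
    finiteDimensional := inferInstanceAs (FiniteDimensional ℝ (Dual ℝ l × a × l))
    form := modelForm l a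
    isAlt := modelForm_isAlt l a
    nondegenerate := modelForm_nondegenerate l a
    closed := x.bracket_closed hx }

end StandardModel

/-! ### The action of `C¹(l, a)` and quadratic cohomology -/

namespace Triple

variable {l : Type v} [AddCommGroup l] [Module ℝ l] {a : SymplecticLieAlgebra.{u}}

/-- The action of `τ ∈ C¹(l, a) = Hom(l, a)` on triples, `(γ, ε, ξ) τ = (γ', ε', ξ')` with
`γ' = γ + τ^* ∘ ξ - τ^* ∘ ad ∘ τ - β₀ ∘ τ`,
`ε' = ε + τ^* α - ev(γ ∧ τ) - τ^* d_ξ τ + ½ β(τ ∧ τ) + ½ τ^* [τ ∧ τ]_a` and `ξ' = ξ - ad ∘ τ`.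
Here `d_ξ τ (L, M) = ξ(L) τ(M) - ξ(M) τ(L)`, `ev(γ ∧ τ)(L, M) = γ(L) τ(M) - γ(M) τ(L)`,
`½ β(τ ∧ τ)(L, M) = β(τ L, τ M)` and `½ [τ ∧ τ]_a (L, M) = [τ L, τ M]_a`. -/
def act (x : Triple l a) (τ : l →ₗ[ℝ] a) : Triple l a where
  γ := LinearMap.mk₂ ℝ
    (fun L A => x.γ L A + starMap τ (x.ξ L A) - starMap τ ⁅τ L, A⁆ - x.β (τ L) A)
    (fun L M A => by simp; abel) (fun c L A => by simp [smul_add, smul_sub])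
    (fun L A B => by simp; abel) (fun c L A => by simp [smul_add, smul_sub])
  ε := LinearMap.mk₂ ℝ
    (fun L M => x.ε L M + starMap τ (x.α L M) - (x.γ L (τ M) - x.γ M (τ L))
      - starMap τ (x.ξ L (τ M) - x.ξ M (τ L)) + x.β (τ L) (τ M) + starMap τ ⁅τ L, τ M⁆)
    (fun L M N => by simp; abel) (fun c L M => by simp [smul_add, smul_sub])
    (fun L M N => by simp; abel) (fun c L M => by simp [smul_add, smul_sub])
  ε_alt L := by simp [x.ε_alt, x.α_self, x.β_self]
  ξ := x.ξ - (LieAlgebra.ad ℝ a : a →ₗ[ℝ] End ℝ a) ∘ₗ τ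

theorem act_γ (x : Triple l a) (τ : l →ₗ[ℝ] a) (L : l) (A : a) :
    (x.act τ).γ L A = x.γ L A + starMap τ (x.ξ L A) - starMap τ ⁅τ L, A⁆ - x.β (τ L) A := rfl

theorem act_ε (x : Triple l a) (τ : l →ₗ[ℝ] a) (L M : l) :
    (x.act τ).ε L M = x.ε L M + starMap τ (x.α L M) - (x.γ L (τ M) - x.γ M (τ L))
      - starMap τ (x.ξ L (τ M) - x.ξ M (τ L)) + x.β (τ L) (τ M) + starMap τ ⁅τ L, τ M⁆ := rfl

theorem act_ξ (x : Triple l a) (τ : l →ₗ[ℝ] a) (L : l) (A : a) :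
    (x.act τ).ξ L A = x.ξ L A - ⁅τ L, A⁆ := rfl

theorem act_β (x : Triple l a) (τ : l →ₗ[ℝ] a) (A B : a) :
    (x.act τ).β A B = x.β A B + starMap τ ⁅A, B⁆ := by
  ext L
  simp only [β_apply, act_ξ, map_sub, LinearMap.sub_apply, LinearMap.add_apply, starMap_apply]
  have h := a.form_cyclic (τ L) A B
  rw [← lie_skew B (τ L), map_neg, LinearMap.neg_apply, a.form_swap ⁅A, B⁆,
    a.form_swap ⁅τ L, B⁆] at h
  linarith

theorem act_α (x : Triple l a) (τ : l →ₗ[ℝ] a) (L M : l) :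
    (x.act τ).α L M = x.α L M - (x.ξ L (τ M) - x.ξ M (τ L)) + ⁅τ L, τ M⁆ := by
  rw [← sub_eq_zero]
  refine a.nondegenerate.1 _ fun A => ?_
  simp only [map_sub, map_add, LinearMap.sub_apply, LinearMap.add_apply, form_α, act_γ,
    β_apply, starMap_apply]
  have h := a.form_cyclic (τ L) (τ M) A
  rw [← lie_skew A (τ L), map_neg, LinearMap.neg_apply, a.form_swap ⁅τ M, A⁆,
    a.form_swap ⁅τ L, A⁆] at h
  linarith [a.form_swap (τ L) (x.ξ M A), a.form_swap (τ M) (x.ξ L A)]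

theorem starMap_add (τ σ : l →ₗ[ℝ] a) (A : a) :
    starMap (τ + σ) A = starMap τ A + starMap σ A := by
  ext L; simp

theorem starMap_zero (A : a) : starMap (0 : l →ₗ[ℝ] a) A = 0 := by
  ext L; simp

theorem act_zero (x : Triple l a) : x.act 0 = x := by
  refine Triple.ext ?_ ?_ ?_ <;> ext <;> simp [act_γ, act_ε, act_ξ, starMap_zero]

theorem act_act (x : Triple l a) (τ σ : l →ₗ[ℝ] a) : (x.act τ).act σ = x.act (τ + σ) := by
  refine Triple.ext ?_ ?_ ?_
  · ext L A M
    simp [act_γ, act_ξ, act_β, starMap_add]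
    ring
  · ext L M N
    simp [act_γ, act_ξ, act_β, act_α, act_ε, starMap_add]
    rw [x.β_swap (τ M), ← lie_skew (σ L) (τ M), map_neg, map_neg, LinearMap.neg_apply]
    ring
  · ext L A
    simp [act_ξ]
    abel

end Triple

section Cohomology

variable (l : Type v) [AddCommGroup l] [Module ℝ l] (a : SymplecticLieAlgebra.{u})

/-- The orbit equivalence relation of the action of `C¹(l, a)` on triples. -/
def cochainSetoid : Setoid (Triple l a) where
  r x y := ∃ τ : l →ₗ[ℝ] a, x.act τ = y
  iseqv :=
    { refl := fun x => ⟨0, x.act_zero⟩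
      symm := by
        rintro x _ ⟨τ, rfl⟩
        exact ⟨-τ, by rw [Triple.act_act, add_neg_cancel, Triple.act_zero]⟩
      trans := by
        rintro x _ _ ⟨τ, rfl⟩ ⟨σ, rfl⟩
        exact ⟨τ + σ, (Triple.act_act x τ σ).symm⟩ }

/-- The orbits of the action of `C¹(l, a)` on triples. The quadratic cohomology sets are subsets
of this set, since a `C¹(l, a)`-orbit that contains a (balanced) cocycle consists of such. -/
abbrev TripleClass : Type (max u v) := Quotient (cochainSetoid l a)

variable {l a}

/-- The class `[γ, ε, ξ]`. -/
def Triple.cls (x : Triple l a) : TripleClass l a := Quotient.mk (cochainSetoid l a) x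

variable (l a)

/-- `H²(l, a, ω_a)₀`: the set of cohomology classes of nilpotent cocycles. -/
def nilpotentCohomology : Set (TripleClass l a) :=
  {c | ∃ x : Triple l a, x.IsNilpotentCocycle ∧ c = x.cls}

end Cohomology

/-! ### The action of `G(l, a, ω_a) = Aut(l) × Aut(a, ω_a)` -/

namespace Triple

variable {l : Type v} [AddCommGroup l] [Module ℝ l] {a : SymplecticLieAlgebra.{u}}

/-- The pull back `(S, U)^* (γ, ε, ξ)`:
`(S, U)^*γ (L) A = S^* (γ(S L) (U⁻¹ A))`, `(S, U)^*ε (L₁, L₂) = S^* (ε(S L₁, S L₂))`,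
`(S, U)^*ξ (L) A = U (ξ(S L) (U⁻¹ A))`. -/
def pullback (S : l ≃ₗ[ℝ] l) (U : SymplecticIso a a) (x : Triple l a) : Triple l a where
  γ := LinearMap.mk₂ ℝ (fun L A => x.γ (S L) (U.toLieEquiv.symm A) ∘ₗ S.toLinearMap)
    (fun L M A => by ext; simp) (fun c L A => by ext; simp)
    (fun L A B => by ext; simp) (fun c L A => by ext; simp)
  ε := LinearMap.mk₂ ℝ (fun L M => x.ε (S L) (S M) ∘ₗ S.toLinearMap)
    (fun L M N => by ext; simp) (fun c L M => by ext; simp)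
    (fun L M N => by ext; simp) (fun c L M => by ext; simp)
  ε_alt L := by ext; simp [x.ε_alt]
  ξ := LinearMap.mk₂ ℝ (fun L A => U.toLieEquiv (x.ξ (S L) (U.toLieEquiv.symm A)))
    (fun L M A => by simp) (fun c L A => by simp)
    (fun L A B => by simp) (fun c L A => by simp)

theorem pullback_γ (S : l ≃ₗ[ℝ] l) (U : SymplecticIso a a) (x : Triple l a) (L M : l) (A : a) :
    (x.pullback S U).γ L A M = x.γ (S L) (U.toLieEquiv.symm A) (S M) := rfl

theorem pullback_ε (S : l ≃ₗ[ℝ] l) (U : SymplecticIso a a) (x : Triple l a) (L M N : l) :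
    (x.pullback S U).ε L M N = x.ε (S L) (S M) (S N) := rfl

theorem pullback_ξ (S : l ≃ₗ[ℝ] l) (U : SymplecticIso a a) (x : Triple l a) (L : l) (A : a) :
    (x.pullback S U).ξ L A = U.toLieEquiv (x.ξ (S L) (U.toLieEquiv.symm A)) := rfl

theorem form_symm (U : SymplecticIso a a) (A B : a) :
    a.form (U.toLieEquiv A) B = a.form A (U.toLieEquiv.symm B) := by
  rw [← U.map_form A, LieEquiv.apply_symm_apply]

theorem pullback_β (S : l ≃ₗ[ℝ] l) (U : SymplecticIso a a) (x : Triple l a) (A B : a) (L : l) :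
    (x.pullback S U).β A B L =
      x.β (U.toLieEquiv.symm A) (U.toLieEquiv.symm B) (S L) := by
  rw [β_apply, β_apply, pullback_ξ, pullback_ξ, form_symm, a.form_swap A, form_symm,
    a.form_swap (U.toLieEquiv.symm A)]

theorem pullback_α (S : l ≃ₗ[ℝ] l) (U : SymplecticIso a a) (x : Triple l a) (L M : l) :
    (x.pullback S U).α L M = U.toLieEquiv (x.α (S L) (S M)) := by
  rw [← sub_eq_zero]
  refine a.nondegenerate.1 _ fun A => ?_
  rw [map_sub, LinearMap.sub_apply, form_α, form_symm, form_α, pullback_γ, pullback_γ, sub_self]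

/-- The pull back `U ∘ τ ∘ S` of a `1`-cochain `τ`. -/
def pullbackCochain (S : l ≃ₗ[ℝ] l) (U : SymplecticIso a a) (τ : l →ₗ[ℝ] a) : l →ₗ[ℝ] a :=
  U.toLieEquiv.toLinearEquiv.toLinearMap ∘ₗ τ ∘ₗ S.toLinearMap

theorem pullbackCochain_apply (S : l ≃ₗ[ℝ] l) (U : SymplecticIso a a) (τ : l →ₗ[ℝ] a) (L : l) :
    pullbackCochain S U τ L = U.toLieEquiv (τ (S L)) := rfl

theorem pullback_act (S : l ≃ₗ[ℝ] l) (U : SymplecticIso a a) (x : Triple l a) (τ : l →ₗ[ℝ] a) :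
    (x.act τ).pullback S U = (x.pullback S U).act (pullbackCochain S U τ) := by
  refine Triple.ext ?_ ?_ ?_
  · ext L A M
    simp [pullback_γ, act_γ, pullback_ξ, pullback_β, pullbackCochain_apply, form_symm,
      LieEquiv.map_lie]
  · ext L M N
    simp [pullback_γ, pullback_ε, act_ε, pullback_ξ, pullback_β, pullback_α,
      pullbackCochain_apply, form_symm, LieEquiv.map_lie]
  · ext L A
    simp [act_ξ, pullback_ξ, pullbackCochain_apply, LieEquiv.map_lie]

theorem pullback_refl (x : Triple l a) :
    x.pullback (LinearEquiv.refl ℝ l) (SymplecticIso.refl a) = x := rfl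

theorem pullback_pullback (S T : l ≃ₗ[ℝ] l) (U V : SymplecticIso a a) (x : Triple l a) :
    (x.pullback S U).pullback T V = x.pullback (T.trans S) (U.trans V) := rfl

end Triple

namespace TripleClass

variable {l : Type v} [AddCommGroup l] [Module ℝ l] {a : SymplecticLieAlgebra.{u}}

/-- `(S, U)^* [γ, ε, ξ] = [(S, U)^* (γ, ε, ξ)]`. -/
def pullback (S : l ≃ₗ[ℝ] l) (U : SymplecticIso a a) (c : TripleClass l a) : TripleClass l a :=
  Quotient.map (sa := cochainSetoid l a) (sb := cochainSetoid l a) (Triple.pullback S U)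
    (by
      rintro x _ ⟨τ, rfl⟩
      exact ⟨Triple.pullbackCochain S U τ, (Triple.pullback_act S U x τ).symm⟩) c

end TripleClass

section Orbits

variable (l : Type v) [AddCommGroup l] [Module ℝ l] (a : SymplecticLieAlgebra.{u})

/-- The orbit equivalence relation of the action of `G(l, a, ω_a)` on `H²(l, a, ω_a)₀`. -/
def orbitSetoid : Setoid (nilpotentCohomology l a) where
  r c d := ∃ (S : l ≃ₗ[ℝ] l) (U : SymplecticIso a a), TripleClass.pullback S U d.1 = c.1
  iseqv :=
    { refl := fun ⟨c, _⟩ => ⟨LinearEquiv.refl ℝ l, SymplecticIso.refl a, by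
        induction c using Quotient.inductionOn with
        | h x => rfl⟩
      symm := by
        rintro ⟨c, hc⟩ ⟨d, hd⟩ ⟨S, U, h⟩
        refine ⟨S.symm, U.symm, ?_⟩
        dsimp only at h ⊢
        subst h
        induction d using Quotient.inductionOn with
        | h x =>
          refine congrArg (Quotient.mk _) ?_
          refine Triple.ext ?_ ?_ ?_ <;> ext <;>
            simp [Triple.pullback_γ, Triple.pullback_ε, Triple.pullback_ξ, SymplecticIso.symm]
      trans := by
        rintro ⟨c, hc⟩ ⟨d, hd⟩ ⟨e, he⟩ ⟨S, U, h⟩ ⟨T, V, h'⟩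
        refine ⟨S.trans T, V.trans U, ?_⟩
        dsimp only at h h' ⊢
        subst h'
        subst h
        induction e using Quotient.inductionOn with
        | h x => rfl }

/-- The orbit space `H²(l, a, ω_a)₀ / G`. -/
abbrev NilpotentOrbits : Type (max u v) := Quotient (orbitSetoid l a)

variable {l a}

/-- The `G`-orbit of the cohomology class of a nilpotent cocycle. -/
def Triple.orbit (x : Triple l a) (hx : x.IsNilpotentCocycle) : NilpotentOrbits l a :=
  Quotient.mk (orbitSetoid l a) ⟨x.cls, x, hx, rfl⟩

end Orbits

end

end SymplecticLie

-- The mechanism is a canonical subspace: the central radical z(g) ∩ z(g)^⊥, preserved by every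
-- isomorphism. Being isotropic, it yields a filtration j ⊆ j^⊥ ⊆ g, with j^⊥/j a smaller symplectic
-- Lie algebra and g/j^⊥ dual to j. In a standard model, "balanced" says exactly that this subspace
-- is l^* (`Triple.IsBalanced.isRadical_iff`, `Triple.IsCocycle.isBalanced`).
--
-- Injectivity: an isomorphism of models of balanced cocycles therefore respects the filtration. It
-- induces a linear isomorphism on l, which recovers m, and a symplectic isomorphism on a, which
-- recovers the representative. After division by the block-diagonal isometry given by these two
-- maps, a unipotent isometry remains, and its Hom(l, a)-component τ turns one triple into the other
-- (`FilteredIso.act_cochain`). Conversely, pull backs and the action of τ are realised by explicit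
-- isometries, so orbits and isomorphism classes match (`Triple.orbit_eq_iff`).
--
-- Surjectivity: if g is nilpotent and non-abelian, closedness makes [g, g] orthogonal to the
-- center, so the radical contains [g, g] ∩ z(g) ≠ 0. A splitting of g along the radical
-- (`exists_splitting`) makes the components of the bracket into a triple. Closedness forces the
-- components α and β, and the Jacobi identity and closedness are the cocycle conditions
-- (`tripleOfEquiv_bracket`, `Triple.isCocycle_of_bracket`). Nilpotency passes between g and the
-- pair (a, ξ) by Engel's theorem and the lower central series.

universe w

namespace SymplecticLie

noncomputable section

/-! ### Isomorphisms of standard models -/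

section ModelIso

variable {l : Type v} [AddCommGroup l] [Module ℝ l] {a : SymplecticLieAlgebra.{u}}

/-- A linear isometry from `l^* ⊕ a ⊕ l` to `g` that respects the brackets, as an isomorphism
from the standard model. -/
def isoOfModelEquiv [FiniteDimensional ℝ l] (x : Triple l a) (hx : x.IsCocycle)
    (g : SymplecticLieAlgebra.{max v u}) (e : (Dual ℝ l × a × l) ≃ₗ[ℝ] g)
    (hb : ∀ X Y, e (x.bracket X Y) = ⁅e X, e Y⁆)
    (hf : ∀ X Y, g.form (e X) (e Y) = modelForm l a X Y) :
    SymplecticIso (standardModel x hx) g where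
  toLieEquiv :=
    { toFun := e
      map_add' := e.map_add
      map_smul' := e.map_smul
      map_lie' := fun {X Y} => hb X Y
      invFun := e.symm
      left_inv := e.symm_apply_apply
      right_inv := e.apply_symm_apply }
  map_form := hf

/-- The isometry `Z + A + L ↦ (Z + τ^* A + ρ L) + (A + τ L) + L` with
`ρ(L)(M) = -½ ω_a(τ L, τ M)`. -/
def shearEquiv (τ : l →ₗ[ℝ] a) : (Dual ℝ l × a × l) ≃ₗ[ℝ] (Dual ℝ l × a × l) where
  toFun X := (X.1 + starMap τ X.2.1 + (1 / 2 : ℝ) • starMap τ (τ X.2.2), X.2.1 + τ X.2.2, X.2.2)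
  map_add' X Y := by
    refine Prod.ext ?_ (Prod.ext ?_ rfl)
    · simp; module
    · simp; abel
  map_smul' c X := by
    refine Prod.ext ?_ (Prod.ext ?_ rfl)
    · simp; module
    · simp
  invFun X := (X.1 - starMap τ X.2.1 + (1 / 2 : ℝ) • starMap τ (τ X.2.2), X.2.1 - τ X.2.2, X.2.2)
  left_inv X := by
    refine Prod.ext ?_ (Prod.ext ?_ rfl)
    · simp; module
    · simp
  right_inv X := by
    refine Prod.ext ?_ (Prod.ext ?_ rfl)
    · simp; module
    · simp

theorem shearEquiv_apply (τ : l →ₗ[ℝ] a) (X : Dual ℝ l × a × l) :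
    shearEquiv τ X = (X.1 + starMap τ X.2.1 + (1 / 2 : ℝ) • starMap τ (τ X.2.2),
      X.2.1 + τ X.2.2, X.2.2) := rfl

/-- The term τ^* A cancels the pairing of A with τ L. The factor ½ makes ρ(L)(M) - ρ(M)(L) cancel
ω_a(τ L, τ M). -/
theorem modelForm_shearEquiv (τ : l →ₗ[ℝ] a) (X Y : Dual ℝ l × a × l) :
    modelForm l a (shearEquiv τ X) (shearEquiv τ Y) = modelForm l a X Y := by
  simp only [modelForm_apply, shearEquiv_apply, LinearMap.add_apply,
    LinearMap.smul_apply, starMap_apply, map_add, smul_eq_mul]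
  linarith [a.form_swap (τ X.2.2) (τ Y.2.2), a.form_swap (τ Y.2.2) X.2.1]

/-- This explains the formulas for the action: they describe the bracket transported by the shear.
The identity needs no cocycle condition. The quadratic term ρ plays no role, because l^* is central
and brackets have no l-component. -/
theorem shearEquiv_bracket (x : Triple l a) (τ : l →ₗ[ℝ] a) (X Y : Dual ℝ l × a × l) :
    shearEquiv τ (x.bracket X Y) = (x.act τ).bracket (shearEquiv τ X) (shearEquiv τ Y) := by
  obtain ⟨Z, A, L⟩ := X
  obtain ⟨W, B, M⟩ := Y
  refine Prod.ext ?_ (Prod.ext ?_ rfl)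
  · ext N
    simp only [Triple.bracket, shearEquiv_apply, Triple.act_γ, Triple.act_ε, Triple.act_β, map_add,
      map_sub, lie_add, add_lie, LinearMap.add_apply, LinearMap.sub_apply, map_zero,
      smul_zero, add_zero, starMap_apply, ← lie_skew (τ M) A,
      ← lie_skew (τ M) (τ L), map_neg, x.β_swap (τ M) A, x.β_swap (τ M) (τ L),
      LinearMap.neg_apply]
    ring
  · simp only [Triple.bracket, shearEquiv_apply, Triple.act_ξ, Triple.act_α, map_add,
      lie_add, add_lie, ← lie_skew (τ M) A, ← lie_skew (τ M) (τ L), map_zero]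
    abel

end ModelIso

/-! ### Pull back by (S, U) as a block-diagonal isometry. -/

section Pullback

variable {l : Type v} [AddCommGroup l] [Module ℝ l] {a : SymplecticLieAlgebra.{u}}

/-- The isometry `Z + A + L ↦ Z ∘ S + U A + S⁻¹ L`. -/
def pullbackEquiv (S : l ≃ₗ[ℝ] l) (U : SymplecticIso a a) :
    (Dual ℝ l × a × l) ≃ₗ[ℝ] (Dual ℝ l × a × l) :=
  S.dualMap.prodCongr (U.toLieEquiv.toLinearEquiv.prodCongr S.symm)

theorem pullbackEquiv_apply (S : l ≃ₗ[ℝ] l) (U : SymplecticIso a a) (X : Dual ℝ l × a × l) :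
    pullbackEquiv S U X = (X.1 ∘ₗ S.toLinearMap, U.toLieEquiv X.2.1, S.symm X.2.2) := rfl

theorem modelForm_pullbackEquiv (S : l ≃ₗ[ℝ] l) (U : SymplecticIso a a)
    (X Y : Dual ℝ l × a × l) :
    modelForm l a (pullbackEquiv S U X) (pullbackEquiv S U Y) = modelForm l a X Y := by
  simp [modelForm_apply, pullbackEquiv_apply, U.map_form]

theorem pullbackEquiv_bracket (S : l ≃ₗ[ℝ] l) (U : SymplecticIso a a) (x : Triple l a)
    (X Y : Dual ℝ l × a × l) :
    pullbackEquiv S U (x.bracket X Y) =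
      (x.pullback S U).bracket (pullbackEquiv S U X) (pullbackEquiv S U Y) := by
  refine Prod.ext ?_ (Prod.ext ?_ ?_)
  · ext N
    simp [Triple.bracket, pullbackEquiv_apply, Triple.pullback_β, Triple.pullback_γ,
      Triple.pullback_ε]
  · simp [Triple.bracket, pullbackEquiv_apply, Triple.pullback_ξ, Triple.pullback_α,
      LieEquiv.map_lie]
  · simp [Triple.bracket, pullbackEquiv_apply]

end Pullback

/-! ### The central radical and its relation to balanced cocycles. -/

section Radical

/-- The intersection of the center of `g` with its orthogonal complement. -/
def centralRadical (g : SymplecticLieAlgebra.{u}) : Submodule ℝ g where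
  carrier := {X | (∀ Y : g, ⁅X, Y⁆ = 0) ∧ ∀ Y : g, (∀ Z : g, ⁅Y, Z⁆ = 0) → g.form X Y = 0}
  zero_mem' := by simp
  add_mem' {X Y} hX hY := ⟨fun Z => by rw [add_lie, hX.1, hY.1, add_zero], fun Z hZ => by
    rw [map_add, LinearMap.add_apply, hX.2 Z hZ, hY.2 Z hZ, add_zero]⟩
  smul_mem' c X hX := ⟨fun Z => by rw [smul_lie, hX.1, smul_zero], fun Z hZ => by
    rw [map_smul, LinearMap.smul_apply, hX.2 Z hZ, smul_zero]⟩

theorem SymplecticIso.mem_centralRadical {g h : SymplecticLieAlgebra.{u}} (φ : SymplecticIso g h)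
    {X : g} (hX : X ∈ centralRadical g) : φ.toLieEquiv X ∈ centralRadical h := by
  refine ⟨fun Y => ?_, fun Y hY => ?_⟩
  · rw [← φ.toLieEquiv.apply_symm_apply Y, ← LieEquiv.map_lie, hX.1, map_zero]
  · rw [← φ.toLieEquiv.apply_symm_apply Y, φ.map_form]
    refine hX.2 _ fun Z => ?_
    rw [← φ.toLieEquiv.symm_apply_apply Z, ← LieEquiv.map_lie, hY, map_zero]

variable {l : Type v} [AddCommGroup l] [Module ℝ l] {a : SymplecticLieAlgebra.{u}}

theorem Triple.bracket_dual (x : Triple l a) (Z : Dual ℝ l) (Y : Dual ℝ l × a × l) :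
    x.bracket (Z, 0, 0) Y = 0 := by
  simp [Triple.bracket]

/-- The four conditions for `A + L` to be central in the standard model. -/
theorem Triple.bracket_eq_zero_iff (x : Triple l a) (X : Dual ℝ l × a × l) :
    (∀ Y, x.bracket X Y = 0) ↔ LieAlgebra.ad ℝ a X.2.1 + x.ξ X.2.2 = 0 ∧
      x.γ X.2.2 + x.β X.2.1 = 0 ∧ x.α X.2.2 = x.ξ.flip X.2.1 ∧ x.ε X.2.2 = x.γ.flip X.2.1 := by
  constructor
  · intro h
    refine ⟨LinearMap.ext fun B => ?_, LinearMap.ext fun B => ?_, LinearMap.ext fun M => ?_,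
      LinearMap.ext fun M => ?_⟩
    · simpa [Triple.bracket] using congrArg (fun X => X.2.1) (h (0, B, 0))
    · simpa [Triple.bracket, add_comm] using congrArg (fun X => X.1) (h (0, B, 0))
    · have := congrArg (fun X => X.2.1) (h (0, 0, M))
      simp only [Triple.bracket, lie_zero, map_zero, zero_add, zero_sub, Prod.snd_zero,
        Prod.fst_zero] at this
      exact (neg_add_eq_zero.1 this).symm
    · have := congrArg (fun X => X.1) (h (0, 0, M))
      simp only [Triple.bracket, map_zero, zero_add, zero_sub, Prod.fst_zero] at this
      exact (neg_add_eq_zero.1 this).symm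
  · rintro ⟨h1, h2, h3, h4⟩ Y
    have h1' := LinearMap.congr_fun h1 Y.2.1
    have h2' := LinearMap.congr_fun h2 Y.2.1
    have h3' := LinearMap.congr_fun h3 Y.2.2
    have h4' := LinearMap.congr_fun h4 Y.2.2
    simp only [LinearMap.add_apply, LieAlgebra.ad_apply, LinearMap.zero_apply,
      LinearMap.flip_apply] at h1' h2' h3' h4'
    refine Prod.ext ?_ (Prod.ext ?_ rfl)
    · simp only [Triple.bracket, h4', Prod.fst_zero]
      rw [← h2']
      abel
    · simp only [Triple.bracket, h3', Prod.fst_zero, Prod.snd_zero]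
      rw [← h1']
      abel

/-- These are the conditions of `Triple.bracket_eq_zero_iff` at L = 0, so `centralPart` is the
a-part of the central elements inside l^* ⊕ a. -/
theorem Triple.mem_centralPart (x : Triple l a) (A : a) :
    A ∈ x.centralPart ↔ LieAlgebra.ad ℝ a A = 0 ∧ x.β A = 0 ∧ x.ξ.flip A = 0 ∧ x.γ.flip A = 0 := by
  have h : A ∈ (LieAlgebra.center ℝ a).toSubmodule ↔ LieAlgebra.ad ℝ a A = 0 := by
    rw [LieSubmodule.mem_toSubmodule, ← LieAlgebra.self_module_ker_eq_center,
      LieModule.mem_ker]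
    exact ⟨fun h => LinearMap.ext h, LinearMap.congr_fun⟩
  simp only [centralPart, Submodule.mem_inf, h, LinearMap.mem_ker, and_assoc]

/-- `X` lies in the central radical of the standard model. -/
def Triple.IsRadical (x : Triple l a) (X : Dual ℝ l × a × l) : Prop :=
  (∀ Y, x.bracket X Y = 0) ∧ ∀ Y, (∀ Z, x.bracket Y Z = 0) → modelForm l a X Y = 0

theorem Triple.mem_centralRadical [FiniteDimensional ℝ l] (x : Triple l a) (hx : x.IsCocycle)
    (X : standardModel x hx) :
    X ∈ centralRadical (standardModel x hx) ↔ x.IsRadical X := Iff.rfl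

theorem Triple.bracket_eq_zero_of_mem_centralPart (x : Triple l a) {A : a}
    (hA : A ∈ x.centralPart) (Z : Dual ℝ l) (Y : Dual ℝ l × a × l) :
    x.bracket (Z, A, 0) Y = 0 := by
  obtain ⟨h1, h2, h3, h4⟩ := (x.mem_centralPart A).1 hA
  refine (x.bracket_eq_zero_iff _).2 ⟨?_, ?_, ?_, ?_⟩ Y <;> simp [h1, h2, h3, h4]

/-- The central elements of the standard model of a balanced cocycle lie in `l^* ⊕ a`. -/
theorem Triple.IsBalanced.central {x : Triple l a} (hx : x.IsBalanced) {X : Dual ℝ l × a × l}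
    (h : ∀ Y, x.bracket X Y = 0) : X.2.2 = 0 ∧ X.2.1 ∈ x.centralPart := by
  obtain ⟨h1, h2, h3, h4⟩ := (x.bracket_eq_zero_iff _).1 h
  have h0 := hx.eq_zero _ _ h1 h2 h3 h4
  refine ⟨h0, (x.mem_centralPart _).2 ⟨?_, ?_, ?_, ?_⟩⟩
  · simpa [h0] using h1
  · simpa [h0] using h2
  · simpa [h0] using h3.symm
  · simpa [h0] using h4.symm

/-- Condition (a) removes the l-component of a central element. Condition (b) then removes the
a-component of a radical one. Conversely, l^* pairs only with l-components, and central elements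
have none. -/
theorem Triple.IsBalanced.isRadical_iff {x : Triple l a} (hx : x.IsBalanced)
    (X : Dual ℝ l × a × l) :
    x.IsRadical X ↔ X.2 = 0 := by
  constructor
  · rintro ⟨h1, h2⟩
    obtain ⟨h3, h4⟩ := hx.central h1
    refine Prod.ext ?_ h3
    have := hx.nondegenerate.1 ⟨X.2.1, h4⟩ fun ⟨B, hB⟩ => by
      have := h2 (0, B, 0) (x.bracket_eq_zero_of_mem_centralPart hB 0)
      rw [modelForm_apply] at this
      simpa using this
    exact congrArg Subtype.val this
  · obtain ⟨Z, W⟩ := X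
    rintro rfl
    refine ⟨x.bracket_dual Z, fun Y hY => ?_⟩
    obtain ⟨h3, -⟩ := hx.central hY
    rw [modelForm_apply, h3]
    simp

/-- If l^* is orthogonal to the center, central elements have no l-component, which is (a). The
center then lies in l^* ⊕ `centralPart`, so an element of `centralPart` orthogonal to `centralPart`
is radical, hence in l^*, hence zero; this is (b). -/
theorem Triple.IsCocycle.isBalanced {x : Triple l a} (hx : x.IsCocycle)
    (h : ∀ X : Dual ℝ l × a × l, x.IsRadical X ↔ X.2 = 0) :
    x.IsBalanced := by
  have central : ∀ X : Dual ℝ l × a × l, (∀ Y, x.bracket X Y = 0) → X.2.2 = 0 := by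
    intro X hX
    rw [← Module.forall_dual_apply_eq_zero_iff ℝ]
    intro Z
    have := ((h (Z, 0, 0)).2 rfl).2 X hX
    rw [modelForm_apply] at this
    simpa using this
  refine { hx with
    eq_zero := fun L A h1 h2 h3 h4 =>
      central (0, A, L) ((x.bracket_eq_zero_iff _).2 ⟨h1, h2, h3, h4⟩)
    nondegenerate := ?_ }
  have key : (a.form.restrict x.centralPart).SeparatingLeft := by
    rintro ⟨A, hA⟩ hB
    have := (h (0, A, 0)).1 ⟨x.bracket_eq_zero_of_mem_centralPart hA 0, fun Y hY => by
      have hL := central Y hY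
      have h5 := (x.bracket_eq_zero_iff _).1 hY
      have h6 : Y.2.1 ∈ x.centralPart := (x.mem_centralPart _).2
        ⟨by simpa [hL] using h5.1, by simpa [hL] using h5.2.1, by simpa [hL] using h5.2.2.1.symm,
          by simpa [hL] using h5.2.2.2.symm⟩
      have h7 := hB ⟨Y.2.1, h6⟩
      rw [modelForm_apply]
      simpa [hL] using h7⟩
    exact Subtype.ext (congrArg Prod.fst this)
  refine ⟨key, fun B hB => key B fun A => ?_⟩
  have := hB A
  rw [LinearMap.BilinForm.restrict_apply] at this ⊢
  rw [LinearMap.domRestrict_apply] at this ⊢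
  rw [a.form_swap, this, neg_zero]

end Radical

/-! ### Isomorphisms that respect the filtration `l^* ⊆ l^* ⊕ a ⊆ l^* ⊕ a ⊕ l` -/

/-- Isometries between two standard models that respect the brackets and the subspaces `l^*`. -/
structure FilteredIso {l l' : Type v} [AddCommGroup l] [Module ℝ l] [AddCommGroup l']
    [Module ℝ l'] {a a' : SymplecticLieAlgebra.{u}} (x : Triple l a) (y : Triple l' a') where
  toLinearEquiv : (Dual ℝ l × a × l) ≃ₗ[ℝ] (Dual ℝ l' × a' × l')
  map_bracket : ∀ X Y,
    toLinearEquiv (x.bracket X Y) = y.bracket (toLinearEquiv X) (toLinearEquiv Y)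
  map_form : ∀ X Y, modelForm l' a' (toLinearEquiv X) (toLinearEquiv Y) = modelForm l a X Y
  map_dual : ∀ Z, (toLinearEquiv (Z, 0, 0)).2 = 0
  symm_map_dual : ∀ Z, (toLinearEquiv.symm (Z, 0, 0)).2 = 0

namespace FilteredIso

section General

variable {l l' : Type v} [AddCommGroup l] [Module ℝ l] [AddCommGroup l'] [Module ℝ l']
  {a a' : SymplecticLieAlgebra.{u}} {x : Triple l a} {y : Triple l' a'}

/-- An isomorphism of the standard models of balanced cocycles respects the filtrations. -/
def ofSymplecticIso [FiniteDimensional ℝ l] [FiniteDimensional ℝ l'] (hx : x.IsBalanced)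
    (hy : y.IsBalanced)
    (φ : SymplecticIso (standardModel x hx.toIsCocycle) (standardModel y hy.toIsCocycle)) :
    FilteredIso x y where
  toLinearEquiv :=
    { toFun := φ.toLieEquiv
      map_add' := φ.toLieEquiv.toLinearEquiv.map_add
      map_smul' := φ.toLieEquiv.toLinearEquiv.map_smul
      invFun := φ.toLieEquiv.symm
      left_inv := φ.toLieEquiv.symm_apply_apply
      right_inv := φ.toLieEquiv.apply_symm_apply }
  map_bracket := fun X Y => φ.toLieEquiv.map_lie X Y
  map_form := φ.map_form
  map_dual Z := (hy.isRadical_iff _).1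
    (φ.mem_centralRadical ((x.mem_centralRadical _ _).2 ((hx.isRadical_iff (Z, 0, 0)).2 rfl)))
  symm_map_dual Z := (hx.isRadical_iff _).1
    (φ.symm.mem_centralRadical ((y.mem_centralRadical _ _).2 ((hy.isRadical_iff (Z, 0, 0)).2 rfl)))

def symm (e : FilteredIso x y) : FilteredIso y x where
  toLinearEquiv := e.toLinearEquiv.symm
  map_bracket X Y := by
    rw [LinearEquiv.symm_apply_eq, e.map_bracket, LinearEquiv.apply_symm_apply,
      LinearEquiv.apply_symm_apply]
  map_form X Y := by
    rw [← e.map_form, LinearEquiv.apply_symm_apply, LinearEquiv.apply_symm_apply]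
  map_dual := e.symm_map_dual
  symm_map_dual := e.map_dual

/-- The subspace l^* ⊕ a is the orthogonal complement of l^*, so an isometry preserving l^*
preserves it too. -/
theorem map_middle (e : FilteredIso x y) (Z : Dual ℝ l) (A : a) :
    (e.toLinearEquiv (Z, A, 0)).2.2 = 0 := by
  rw [← Module.forall_dual_apply_eq_zero_iff ℝ]
  intro W
  have h := e.map_form (e.toLinearEquiv.symm (W, 0, 0)) (Z, A, 0)
  rw [LinearEquiv.apply_symm_apply, modelForm_apply, modelForm_apply, e.symm_map_dual] at h
  simpa using h

/-- The map induced on `a`. -/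
def middleMap (e : FilteredIso x y) : a →ₗ[ℝ] a' :=
  LinearMap.fst ℝ a' l' ∘ₗ LinearMap.snd ℝ (Dual ℝ l') (a' × l') ∘ₗ e.toLinearEquiv.toLinearMap ∘ₗ
    LinearMap.inr ℝ (Dual ℝ l) (a × l) ∘ₗ LinearMap.inl ℝ a l

/-- The map induced on `l`. -/
def topMap (e : FilteredIso x y) : l →ₗ[ℝ] l' :=
  LinearMap.snd ℝ a' l' ∘ₗ LinearMap.snd ℝ (Dual ℝ l') (a' × l') ∘ₗ e.toLinearEquiv.toLinearMap ∘ₗ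
    LinearMap.inr ℝ (Dual ℝ l) (a × l) ∘ₗ LinearMap.inr ℝ a l

theorem middleMap_apply (e : FilteredIso x y) (A : a) :
    e.middleMap A = (e.toLinearEquiv (0, A, 0)).2.1 := rfl

theorem topMap_apply (e : FilteredIso x y) (L : l) :
    e.topMap L = (e.toLinearEquiv (0, 0, L)).2.2 := rfl

theorem middleMap_eq (e : FilteredIso x y) (Z : Dual ℝ l) (A : a) :
    (e.toLinearEquiv (Z, A, 0)).2.1 = e.middleMap A := by
  have h : ((Z, A, 0) : Dual ℝ l × a × l) = (Z, 0, 0) + (0, A, 0) := by simp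
  rw [h, map_add, Prod.snd_add, e.map_dual, zero_add, middleMap_apply]

theorem topMap_eq (e : FilteredIso x y) (X : Dual ℝ l × a × l) :
    (e.toLinearEquiv X).2.2 = e.topMap X.2.2 := by
  have h : X = (X.1, X.2.1, 0) + (0, 0, X.2.2) := by simp
  conv_lhs => rw [h]
  rw [map_add, Prod.snd_add, Prod.snd_add, e.map_middle, zero_add, topMap_apply]

theorem middleMap_symm_middleMap (e : FilteredIso x y) (A : a) :
    e.symm.middleMap (e.middleMap A) = A := by
  have h : e.toLinearEquiv (0, A, 0) = ((e.toLinearEquiv (0, A, 0)).1, e.middleMap A, 0) :=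
    Prod.ext rfl (Prod.ext rfl (e.map_middle 0 A))
  rw [← e.symm.middleMap_eq (e.toLinearEquiv (0, A, 0)).1, ← h]
  change (e.toLinearEquiv.symm _).2.1 = A
  rw [LinearEquiv.symm_apply_apply]

theorem topMap_symm_topMap (e : FilteredIso x y) (L : l) :
    e.symm.topMap (e.topMap L) = L := by
  rw [topMap_apply e, ← e.symm.topMap_eq (e.toLinearEquiv (0, 0, L))]
  change (e.toLinearEquiv.symm _).2.2 = L
  rw [LinearEquiv.symm_apply_apply]

/-- The linear isomorphism induced on `l`. -/
def topEquiv (e : FilteredIso x y) : l ≃ₗ[ℝ] l' :=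
  LinearEquiv.ofLinearMap e.topMap e.symm.topMap (LinearMap.ext e.symm.topMap_symm_topMap)
    (LinearMap.ext e.topMap_symm_topMap)

/-- The isomorphism of symplectic Lie algebras induced on `a`. -/
def middleIso (e : FilteredIso x y) : SymplecticIso a a' where
  toLieEquiv :=
    { e.middleMap with
      map_lie' := fun {A B} => by
        have h := congrArg (fun X => X.2.1) (e.map_bracket (0, A, 0) (0, B, 0))
        simp only [Triple.bracket, map_zero, LinearMap.zero_apply, add_zero, sub_zero,
          e.middleMap_eq, e.map_middle] at h
        exact h
      invFun := e.symm.middleMap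
      left_inv := e.middleMap_symm_middleMap
      right_inv := e.symm.middleMap_symm_middleMap }
  map_form A B := by
    have h := e.map_form (0, A, 0) (0, B, 0)
    simp only [modelForm_apply, e.middleMap_eq, e.map_middle, map_zero, zero_add,
      sub_zero] at h
    exact h

theorem middleIso_apply (e : FilteredIso x y) (A : a) :
    e.middleIso.toLieEquiv A = e.middleMap A := rfl

theorem topEquiv_apply (e : FilteredIso x y) (L : l) : e.topEquiv L = e.topMap L := rfl

end General

variable {l : Type v} [AddCommGroup l] [Module ℝ l] {a : SymplecticLieAlgebra.{u}}
  {x y : Triple l a}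

/-- The component in `Hom(l, a)`. -/
def cochain (e : FilteredIso x y) : l →ₗ[ℝ] a :=
  LinearMap.fst ℝ a l ∘ₗ LinearMap.snd ℝ (Dual ℝ l) (a × l) ∘ₗ e.toLinearEquiv.toLinearMap ∘ₗ
    LinearMap.inr ℝ (Dual ℝ l) (a × l) ∘ₗ LinearMap.inr ℝ a l

/-- With trivial induced maps on a and l, the form forces the identity on l^* and the component τ^*
from a to l^*. The component from l to l^* stays free, but it cannot enter a bracket. Comparing
brackets then yields the formulas of the action. -/
theorem act_cochain (e : FilteredIso x y) (hm : ∀ A, e.middleMap A = A)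
    (ht : ∀ L, e.topMap L = L) : x.act e.cochain = y := by
  have eL : ∀ L, e.toLinearEquiv (0, 0, L) = ((e.toLinearEquiv (0, 0, L)).1, e.cochain L, L) :=
    fun L => Prod.ext rfl (Prod.ext rfl (by rw [e.topMap_eq, ht]))
  have eA : ∀ A, e.toLinearEquiv (0, A, 0) = (starMap e.cochain A, A, 0) := by
    intro A
    refine Prod.ext (LinearMap.ext fun L => ?_)
      (Prod.ext (by rw [e.middleMap_eq, hm]) (e.map_middle 0 A))
    have h := e.map_form (0, A, 0) (0, 0, L)
    rw [eL] at h
    simp only [modelForm_apply, e.middleMap_eq, e.map_middle, map_zero, LinearMap.zero_apply,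
      zero_add, sub_zero, hm] at h
    rw [starMap_apply, a.form_swap]
    linarith
  have eZ : ∀ Z, e.toLinearEquiv (Z, 0, 0) = (Z, 0, 0) := by
    intro Z
    refine Prod.ext (LinearMap.ext fun L => ?_) (e.map_dual Z)
    have h := e.map_form (Z, 0, 0) (0, 0, L)
    rw [eL] at h
    simpa [modelForm_apply, e.map_dual] using h
  have eX : ∀ Z A, e.toLinearEquiv (Z, A, 0) = (Z + starMap e.cochain A, A, 0) := by
    intro Z A
    have h : ((Z, A, 0) : Dual ℝ l × a × l) = (Z, 0, 0) + (0, A, 0) := by simp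
    rw [h, map_add, eZ, eA]
    simp
  have hLA : ∀ L A, x.γ L A + starMap e.cochain (x.ξ L A) =
      y.γ L A + y.β (e.cochain L) A ∧ x.ξ L A = y.ξ L A + ⁅e.cochain L, A⁆ := by
    intro L A
    have h := e.map_bracket (0, 0, L) (0, A, 0)
    rw [eL, eA] at h
    simp only [Triple.bracket, map_zero, LinearMap.zero_apply, zero_add, sub_zero, zero_lie,
      add_zero, eX, Prod.mk.injEq] at h
    exact ⟨by rw [h.1, add_comm], by rw [h.2.1, add_comm]⟩
  have hβ : ∀ A B, x.β A B + starMap e.cochain ⁅A, B⁆ = y.β A B := by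
    intro A B
    have h := e.map_bracket (0, A, 0) (0, B, 0)
    rw [eA, eA] at h
    simp only [Triple.bracket, map_zero, LinearMap.zero_apply, sub_zero,
      add_zero, eX, Prod.mk.injEq] at h
    exact h.1
  have hξ : ∀ L A, (x.act e.cochain).ξ L A = y.ξ L A := fun L A => by
    rw [Triple.act_ξ, (hLA L A).2, add_sub_cancel_right]
  have hγ : ∀ L A, (x.act e.cochain).γ L A = y.γ L A := fun L A => by
    rw [Triple.act_γ, (hLA L A).1, ← hβ]
    abel
  have hε : ∀ L M, (x.act e.cochain).ε L M = y.ε L M := by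
    intro L M
    have h := e.map_bracket (0, 0, L) (0, 0, M)
    rw [eL L, eL M] at h
    simp only [Triple.bracket, map_zero, zero_add, sub_zero, zero_lie,
      eX, Prod.mk.injEq] at h
    -- The bracket of the images involves γ and β of `y`, the action those of `x`. The relations
    -- already found, evaluated at τ M and τ L, convert one into the other.
    have h1 := (hLA L (e.cochain M)).1
    have h2 := (hLA M (e.cochain L)).1
    have h3 := hβ (e.cochain L) (e.cochain M)
    rw [Triple.act_ε]
    have h4 := y.β_swap (e.cochain M) (e.cochain L)
    simp only [map_sub]
    linear_combination (norm := module) h.1 - h1 + h2 + h3 + h4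
  exact Triple.ext (LinearMap.ext₂ hγ) (LinearMap.ext₂ hε) (LinearMap.ext₂ hξ)

/-- The isometry `Z + A + L ↦ Z ∘ S + U A + S⁻¹ L` as a filtered isomorphism. -/
def ofPullback (S : l ≃ₗ[ℝ] l) (U : SymplecticIso a a) (x : Triple l a) :
    FilteredIso x (x.pullback S U) where
  toLinearEquiv := pullbackEquiv S U
  map_bracket := pullbackEquiv_bracket S U x
  map_form := modelForm_pullbackEquiv S U
  map_dual Z := by simp [pullbackEquiv_apply]
  symm_map_dual Z := by simp [pullbackEquiv]

def trans {z : Triple l a} (e : FilteredIso x y) (f : FilteredIso y z) : FilteredIso x z where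
  toLinearEquiv := e.toLinearEquiv.trans f.toLinearEquiv
  map_bracket X Y := by simp [e.map_bracket, f.map_bracket]
  map_form X Y := by simp [e.map_form, f.map_form]
  map_dual Z := by
    have h : e.toLinearEquiv (Z, 0, 0) = ((e.toLinearEquiv (Z, 0, 0)).1, 0, 0) :=
      Prod.ext rfl (e.map_dual Z)
    rw [LinearEquiv.trans_apply, h, f.map_dual]
  symm_map_dual Z := by
    have h : f.toLinearEquiv.symm (Z, 0, 0) = ((f.toLinearEquiv.symm (Z, 0, 0)).1, 0, 0) :=
      Prod.ext rfl (f.symm_map_dual Z)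
    rw [LinearEquiv.trans_symm, LinearEquiv.trans_apply, h, e.symm_map_dual]

/-- Dividing by the block-diagonal isometry with the same induced maps leaves a filtered isomorphism
inducing the identity on a and l. The inverse of the map on l appears because pull back by S acts on
l as S⁻¹. -/
theorem exists_act_pullback_eq (e : FilteredIso x y) :
    ∃ (S : l ≃ₗ[ℝ] l) (U : SymplecticIso a a) (τ : l →ₗ[ℝ] a), (x.pullback S U).act τ = y := by
  refine ⟨e.topEquiv.symm, e.middleIso,
    ((ofPullback e.topEquiv.symm e.middleIso x).symm.trans e).cochain, act_cochain _ ?_ ?_⟩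
  · intro A
    rw [middleMap_apply]
    change (e.toLinearEquiv ((pullbackEquiv _ _).symm (0, A, 0))).2.1 = A
    have h : (pullbackEquiv e.topEquiv.symm e.middleIso).symm (0, A, 0) =
        (0, e.middleIso.toLieEquiv.symm A, 0) := by
      rw [LinearEquiv.symm_apply_eq, pullbackEquiv_apply]
      simp
    rw [h, e.middleMap_eq, ← middleIso_apply, LieEquiv.apply_symm_apply]
  · intro L
    rw [topMap_apply]
    change (e.toLinearEquiv ((pullbackEquiv _ _).symm (0, 0, L))).2.2 = L
    have h : (pullbackEquiv e.topEquiv.symm e.middleIso).symm (0, 0, L) =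
        (0, 0, e.topEquiv.symm L) := by
      rw [LinearEquiv.symm_apply_eq, pullbackEquiv_apply]
      simp
    rw [h, ← topMap_apply, ← topEquiv_apply, LinearEquiv.apply_symm_apply]

end FilteredIso

/-! ### Orbits correspond to isomorphism classes of models. -/

section Orbit

variable {l : Type v} [AddCommGroup l] [Module ℝ l] [FiniteDimensional ℝ l]
  {a : SymplecticLieAlgebra.{u}} {x y : Triple l a}

theorem Triple.orbit_eq_iff (hx : x.IsNilpotentCocycle) (hy : y.IsNilpotentCocycle) :
    x.orbit hx = y.orbit hy ↔
      Nonempty (SymplecticIso (standardModel x hx.toIsCocycle)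
        (standardModel y hy.toIsCocycle)) := by
  constructor
  · intro h
    -- The orbit relation pulls back its second argument; reading the equality backwards presents
    -- the class of `y` as a pull back of that of `x`.
    obtain ⟨S, U, h⟩ := Quotient.exact h.symm
    obtain ⟨τ, rfl⟩ := Quotient.exact (s := cochainSetoid l a) h
    exact ⟨isoOfModelEquiv x hx.toIsCocycle (standardModel _ hy.toIsCocycle)
      ((pullbackEquiv S U).trans (shearEquiv τ))
      (fun X Y => by
        change shearEquiv τ (pullbackEquiv S U (x.bracket X Y)) = _
        rw [pullbackEquiv_bracket, shearEquiv_bracket]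
        rfl)
      fun X Y => (modelForm_shearEquiv τ _ _).trans (modelForm_pullbackEquiv S U X Y)⟩
  · rintro ⟨φ⟩
    obtain ⟨S, U, τ, h⟩ :=
      (FilteredIso.ofSymplecticIso hx.toIsBalanced hy.toIsBalanced φ).exists_act_pullback_eq
    refine (Quotient.sound (s := orbitSetoid l a) ⟨S, U, ?_⟩).symm
    exact Quotient.sound (s := cochainSetoid l a) ⟨τ, h⟩

end Orbit

/-! ### Nilpotency of the standard model -/

section Nilpotency

/-- By the Leibniz rule, D[B, C] is a sum of two brackets, each with second entry C or D C, and
induction applies to D C. -/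
theorem derivation_mem_lowerCentralSeries {a : Type*} [LieRing a] [LieAlgebra ℝ a] (D : End ℝ a)
    (hD : ∀ A B, D ⁅A, B⁆ = ⁅D A, B⁆ + ⁅A, D B⁆) (k : ℕ) {A : a}
    (hA : A ∈ LieModule.lowerCentralSeries ℝ a a k) :
    D A ∈ LieModule.lowerCentralSeries ℝ a a k := by
  induction k generalizing A with
  | zero => simp
  | succ k ih =>
    rw [LieModule.lowerCentralSeries_succ, ← LieSubmodule.mem_toSubmodule,
      LieSubmodule.lieIdeal_oper_eq_linear_span'] at hA
    induction hA using Submodule.span_induction with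
    | mem A h =>
      obtain ⟨B, -, C, hC, rfl⟩ := h
      rw [hD, LieModule.lowerCentralSeries_succ]
      exact add_mem (LieSubmodule.lie_mem_lie (LieSubmodule.mem_top _) hC)
        (LieSubmodule.lie_mem_lie (LieSubmodule.mem_top _) (ih hC))
    | zero => rw [map_zero]; exact zero_mem _
    | add A B _ _ hA hB => rw [map_add]; exact add_mem hA hB
    | smul c A _ hA => rw [map_smul]; exact SMulMemClass.smul_mem c hA

/-- A nilpotent derivation of a nilpotent Lie algebra plus an inner derivation is nilpotent. -/
theorem isNilpotent_ad_add_derivation {a : Type*} [LieRing a] [LieAlgebra ℝ a]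
    [LieRing.IsNilpotent a] (D : End ℝ a) (hD : ∀ A B, D ⁅A, B⁆ = ⁅D A, B⁆ + ⁅A, D B⁆)
    (hn : IsNilpotent D) (A : a) : IsNilpotent ((LieAlgebra.ad ℝ a A : End ℝ a) + D) := by
  obtain ⟨N, hN⟩ := hn
  set E : End ℝ a := (LieAlgebra.ad ℝ a A : End ℝ a) + D with hE
  have ad_mem : ∀ k, ∀ B ∈ LieModule.lowerCentralSeries ℝ a a k,
      ⁅A, B⁆ ∈ LieModule.lowerCentralSeries ℝ a a (k + 1) := fun k B hB => by
    rw [LieModule.lowerCentralSeries_succ]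
    exact LieSubmodule.lie_mem_lie (LieSubmodule.mem_top _) hB
  have E_mem : ∀ k, ∀ B ∈ LieModule.lowerCentralSeries ℝ a a k,
      E B ∈ LieModule.lowerCentralSeries ℝ a a k := fun k B hB =>
    add_mem (LieModule.antitone_lowerCentralSeries ℝ a a k.le_succ (ad_mem k B hB))
      (derivation_mem_lowerCentralSeries D hD k hB)
  have D_pow_mem : ∀ k j, ∀ B ∈ LieModule.lowerCentralSeries ℝ a a k,
      (D ^ j) B ∈ LieModule.lowerCentralSeries ℝ a a k := fun k j B hB => by
    induction j with
    | zero => simpa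
    | succ j ih =>
      rw [pow_succ', Module.End.mul_apply]
      exact derivation_mem_lowerCentralSeries D hD k ih
  -- Modulo the next term of the lower central series ad A vanishes, so E and D have the same powers
  -- there.
  have sub_mem' : ∀ k j, ∀ B ∈ LieModule.lowerCentralSeries ℝ a a k,
      (E ^ j) B - (D ^ j) B ∈ LieModule.lowerCentralSeries ℝ a a (k + 1) := fun k j B hB => by
    induction j with
    | zero => simp
    | succ j ih =>
      have h : (E ^ (j + 1)) B - (D ^ (j + 1)) B =
          E ((E ^ j) B - (D ^ j) B) + ⁅A, (D ^ j) B⁆ := by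
        rw [pow_succ', pow_succ', Module.End.mul_apply, Module.End.mul_apply, map_sub]
        simp only [hE, LinearMap.add_apply, LieAlgebra.ad_apply]
        abel
      rw [h]
      exact add_mem (E_mem _ _ ih) (ad_mem _ _ (D_pow_mem _ _ _ hB))
  -- As D^N = 0, every N applications of E descend one term of the series.
  have pow_mem' : ∀ k B, (E ^ (N * k)) B ∈ LieModule.lowerCentralSeries ℝ a a k := fun k B => by
    induction k with
    | zero => simp
    | succ k ih =>
      have := sub_mem' k N _ ih
      rwa [hN, LinearMap.zero_apply, sub_zero, ← Module.End.mul_apply, ← pow_add,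
        show N + N * k = N * (k + 1) by ring] at this
  obtain ⟨k, hk⟩ := LieModule.IsNilpotent.nilpotent ℝ a a
  refine ⟨N * k, LinearMap.ext fun B => ?_⟩
  simpa [hk] using pow_mem' k B

variable {l : Type v} [AddCommGroup l] [Module ℝ l] {a : SymplecticLieAlgebra.{u}}

/-- On (l^* ⊕ a)/l^* ≅ a, the operator ad(Z + A + L) acts as ad A + ξ(L). Nilpotency questions about
the model thus become questions about a and ξ. -/
theorem Triple.iterate_bracket (x : Triple l a) (X Y : Dual ℝ l × a × l) (hY : Y.2.2 = 0)
    (k : ℕ) : ((x.bracket X)^[k] Y).2 =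
      (((LieAlgebra.ad ℝ a X.2.1 + x.ξ X.2.2 : End ℝ a) ^ k) Y.2.1, 0) := by
  induction k with
  | zero => exact Prod.ext rfl hY
  | succ k ih =>
    rw [Function.iterate_succ_apply', pow_succ', Module.End.mul_apply]
    generalize (x.bracket X)^[k] Y = W at ih
    simp [bracket, ih]

variable [FiniteDimensional ℝ l]

theorem standardModel_ad_pow (x : Triple l a) (hx : x.IsCocycle) (X Y : standardModel x hx)
    (k : ℕ) : (LieAlgebra.ad ℝ (standardModel x hx) X ^ k) Y = (x.bracket X)^[k] Y := by
  rw [Module.End.pow_apply]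
  rfl

/-- By Engel's theorem only single operators ad X matter, and these are controlled by a nilpotent
derivation plus an inner one. -/
theorem Triple.IsNilpotentCocycle.isNilpotent_standardModel {x : Triple l a}
    (hx : x.IsNilpotentCocycle) (ha : LieRing.IsNilpotent a) :
    LieRing.IsNilpotent (standardModel x hx.toIsCocycle) := by
  rw [LieAlgebra.isNilpotent_iff_forall (R := ℝ)]
  intro X
  have hξ : IsNilpotent (x.ξ X.2.2) := by
    obtain ⟨N, hN⟩ := hx.nilpotent
    exact ⟨N, by simpa using hN (List.replicate N X.2.2) (by simp)⟩
  obtain ⟨K, hK⟩ :=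
    isNilpotent_ad_add_derivation (x.ξ X.2.2) (hx.derivation X.2.2) hξ X.2.1
  -- One bracket enters l^* ⊕ a, K more reach the central l^*, and a last one gives zero.
  refine ⟨K + 2, LinearMap.ext fun Y => ?_⟩
  refine (standardModel_ad_pow x hx.toIsCocycle X Y (K + 2)).trans ?_
  have h := x.iterate_bracket X (x.bracket X Y) rfl K
  rw [hK, LinearMap.zero_apply] at h
  refine (Function.iterate_succ_apply' (x.bracket X) (K + 1) Y).trans ?_
  refine (congrArg (x.bracket X) (Function.iterate_succ_apply (x.bracket X) K Y)).trans ?_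
  generalize (x.bracket X)^[K] (x.bracket X Y) = W at h
  obtain ⟨Z, W⟩ := W
  obtain rfl : W = 0 := h
  simp [bracket]
  rfl

theorem isNilpotent_of_standardModel {x : Triple l a} {hx : x.IsCocycle}
    (h : LieRing.IsNilpotent (standardModel x hx)) : LieRing.IsNilpotent a := by
  rw [LieAlgebra.isNilpotent_iff_forall (R := ℝ)] at h ⊢
  intro A
  obtain ⟨K, hK⟩ := h (show Dual ℝ l × a × l from (0, A, 0))
  refine ⟨K, LinearMap.ext fun B => ?_⟩
  have h1 : (x.bracket (0, A, 0))^[K] (0, B, 0) = 0 :=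
    (standardModel_ad_pow x hx (0, A, 0) (0, B, 0) K).symm.trans (LinearMap.congr_fun hK _)
  have h2 := x.iterate_bracket (0, A, 0) (0, B, 0) rfl K
  rw [h1, map_zero, add_zero] at h2
  exact (congrArg Prod.fst h2).symm

/-- Products of different ξ(L) must vanish uniformly, so Engel's criterion is not enough. The
iterated bracket [L₁, [L₂, …, [L_N, A]]] lies in the N-th lower central term, and its a-component is
the product applied to A. -/
theorem Triple.exists_prod_eq_zero {x : Triple l a} {hx : x.IsCocycle}
    (h : LieRing.IsNilpotent (standardModel x hx)) :
    ∃ N : ℕ, ∀ Ls : List l, Ls.length = N → (Ls.map x.ξ).prod = 0 := by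
  have key : ∀ (Ls : List l) (A : a), ∃ Y : standardModel x hx,
      Y ∈ LieModule.lowerCentralSeries ℝ (standardModel x hx) (standardModel x hx) Ls.length ∧
        (show Dual ℝ l × a × l from Y).2 = ((Ls.map x.ξ).prod A, 0) := by
    intro Ls A
    induction Ls with
    | nil => exact ⟨(0, A, 0), LieSubmodule.mem_top _, rfl⟩
    | cons L Ls ih =>
      obtain ⟨Y, hY, hY'⟩ := ih
      refine ⟨⁅(show standardModel x hx from (0, 0, L)), Y⁆, ?_, ?_⟩
      · rw [List.length_cons, LieModule.lowerCentralSeries_succ]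
        exact LieSubmodule.lie_mem_lie (LieSubmodule.mem_top _) hY
      · change (x.bracket (0, 0, L) Y).2 = _
        change Y.2 = _ at hY'
        simp [bracket, hY']
  obtain ⟨N, hN⟩ := LieModule.IsNilpotent.nilpotent ℝ (standardModel x hx) (standardModel x hx)
  refine ⟨N, fun Ls hLs => LinearMap.ext fun A => ?_⟩
  obtain ⟨Y, hY, hY'⟩ := key Ls A
  rw [hLs, hN, LieSubmodule.mem_bot] at hY
  rw [hY] at hY'
  exact (congrArg Prod.fst hY').symm

end Nilpotency

/-! ### The central radical of a nilpotent symplectic Lie algebra -/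

/-- Closedness makes [g, g] orthogonal to the center, so [g, g] ∩ z(g) lies in the radical. In a
nilpotent algebra, [g, g] is zero if it meets the center trivially. -/
theorem isLieAbelian_of_centralRadical_eq_bot {g : SymplecticLieAlgebra.{u}}
    [LieRing.IsNilpotent g] (h : centralRadical g = ⊥) : IsLieAbelian g := by
  refine (LieModule.disjoint_lowerCentralSeries_maxTrivSubmodule_iff ℝ g g).1 ?_
  rw [← LieSubmodule.disjoint_toSubmodule, Submodule.disjoint_def]
  intro X hX hZ
  have hZ' : ∀ Y : g, ⁅X, Y⁆ = 0 := fun Y => by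
    rw [← lie_skew, neg_eq_zero]
    exact hZ Y
  rw [← Submodule.mem_bot ℝ, ← h]
  refine ⟨hZ', fun Y hY => ?_⟩
  rw [LieModule.lowerCentralSeries_succ, LieSubmodule.lieIdeal_oper_eq_linear_span'] at hX
  clear hZ hZ'
  induction hX using Submodule.span_induction with
  | mem X hX =>
    obtain ⟨A, -, B, -, rfl⟩ := hX
    have h := g.form_cyclic A B Y
    rw [← lie_skew B Y, hY, hY] at h
    simpa using h
  | zero => simp
  | add A B _ _ hA hB => rw [map_add, LinearMap.add_apply, hA, hB, add_zero]
  | smul c A _ hA => rw [map_smul, LinearMap.smul_apply, hA, smul_zero]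

theorem centralRadical_eq_bot {g : SymplecticLieAlgebra.{u}} (h : IsLieAbelian g) :
    centralRadical g = ⊥ := by
  refine (Submodule.eq_bot_iff _).2 fun X hX => g.nondegenerate.1 X fun Y => ?_
  exact hX.2 Y fun Z => h.trivial Y Z

/-! ### Reduction by a central isotropic subspace -/

/-- The splitting `g = l^* ⊕ V ⊕ l` of a symplectic vector space defined by an isotropic
subspace. -/
theorem exists_splitting (g : SymplecticLieAlgebra.{u}) (j : Submodule ℝ g)
    (hj : ∀ X ∈ j, ∀ Y ∈ j, g.form X Y = 0) :
    ∃ (V : Submodule ℝ g) (e : (Dual ℝ (Fin (finrank ℝ j) → ℝ) × V × (Fin (finrank ℝ j) → ℝ))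
        ≃ₗ[ℝ] g), (∀ X, e X ∈ j ↔ X.2 = 0) ∧ (g.form.restrict V).Nondegenerate ∧
      ∀ X Y, g.form (e X) (e Y) = X.1 Y.2.2 + g.form X.2.1 Y.2.1 - Y.1 X.2.2 := by
  let l := Fin (finrank ℝ j) → ℝ
  have hd : finrank ℝ (Dual ℝ l) = finrank ℝ j := by
    rw [Subspace.dual_finrank_eq]
    exact finrank_fin_fun ℝ
  let i : Dual ℝ l ≃ₗ[ℝ] j := LinearEquiv.ofFinrankEq _ _ hd
  let ι : Dual ℝ l →ₗ[ℝ] g := j.subtype ∘ₗ i.toLinearMap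
  have ι_mem : ∀ Z, ι Z ∈ j := fun Z => (i Z).2
  have ι_inj : Function.Injective ι := j.subtype_injective.comp i.injective
  -- Pairing with j gives a functional on l^*, that is, a vector of l; this is the projection to l.
  let Q : g →ₗ[ℝ] l := (evalEquiv ℝ l).symm.toLinearMap ∘ₗ (g.form ∘ₗ ι).flip
  have hQ : ∀ Z X, Z (Q X) = g.form (ι Z) X := fun Z X =>
    apply_evalEquiv_symm_apply (R := ℝ) (M := l) Z ((g.form ∘ₗ ι).flip X)
  have Q_surj : Function.Surjective Q := by
    intro L
    obtain ⟨G, hG⟩ := LinearMap.dualMap_surjective_of_injective ι_inj (Dual.eval ℝ l L)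
    -- `G` extends evaluation at `L` from j to g. The sign compensates for j standing in the first
    -- slot of the form in `hQ`.
    refine ⟨(g.form.toDual g.nondegenerate).symm (-G), ?_⟩
    rw [← sub_eq_zero, ← Module.forall_dual_apply_eq_zero_iff ℝ]
    intro Z
    rw [map_sub, hQ, g.form_swap, LinearMap.BilinForm.apply_toDual_symm_apply]
    have := LinearMap.congr_fun hG Z
    rw [LinearMap.dualMap_apply, Dual.eval_apply] at this
    rw [LinearMap.neg_apply, this]
    ring
  obtain ⟨s₀, hs₀⟩ := Q.exists_rightInverse_of_surjective (LinearMap.range_eq_top.2 Q_surj)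
  have hs₀' : ∀ Z L, g.form (ι Z) (s₀ L) = Z L := fun Z L => by
    rw [← hQ]
    exact congrArg Z (LinearMap.congr_fun hs₀ L)
  -- The section `s₀` need not have isotropic image. Adding the j-valued correction ρ with factor -½
  -- makes it isotropic without changing its pairing with j.
  let ρ : l →ₗ[ℝ] Dual ℝ l := (-(1 / 2) : ℝ) • g.form.compl₁₂ s₀ s₀
  have hρ : ∀ L M, ρ L M = -(1 / 2) * g.form (s₀ L) (s₀ M) := fun L M => rfl
  let s : l →ₗ[ℝ] g := s₀ + ι ∘ₗ ρ
  have hs : ∀ L, s L = s₀ L + ι (ρ L) := fun L => rfl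
  have hιι : ∀ Z W, g.form (ι Z) (ι W) = 0 := fun Z W => hj _ (ι_mem Z) _ (ι_mem W)
  have hιs : ∀ Z L, g.form (ι Z) (s L) = Z L := fun Z L => by
    rw [hs, map_add, hιι, add_zero, hs₀']
  have hsι : ∀ L Z, g.form (s L) (ι Z) = -Z L := fun L Z => by rw [g.form_swap, hιs]
  have hss : ∀ L M, g.form (s L) (s M) = 0 := fun L M => by
    rw [hs L, map_add, LinearMap.add_apply, hιs, hs M, map_add, g.form_swap (s₀ L) (ι _),
      hs₀', hρ, hρ, g.form_swap (s₀ M)]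
    ring
  let V : Submodule ℝ g := LinearMap.ker (g.form ∘ₗ ι).flip ⊓ LinearMap.ker (g.form ∘ₗ s).flip
  have mem_V : ∀ v, v ∈ V ↔ (∀ Z, g.form (ι Z) v = 0) ∧ ∀ L, g.form (s L) v = 0 := fun v => by
    rw [Submodule.mem_inf, LinearMap.mem_ker, LinearMap.mem_ker, LinearMap.ext_iff,
      LinearMap.ext_iff]
    rfl
  let f : (Dual ℝ l × V × l) →ₗ[ℝ] g := ι.coprod (V.subtype.coprod s)
  have hf : ∀ X, f X = ι X.1 + (X.2.1 + s X.2.2) := fun X => rfl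
  have f_form : ∀ X Y, g.form (f X) (f Y) = X.1 Y.2.2 + g.form X.2.1 Y.2.1 - Y.1 X.2.2 := by
    intro X Y
    have hX := (mem_V _).1 X.2.1.2
    have hY := (mem_V _).1 Y.2.1.2
    simp only [hf, map_add, LinearMap.add_apply, hιι, hιs, hsι, hss, hY.1, hY.2,
      g.form_swap X.2.1 (ι _), g.form_swap X.2.1 (s _), hX.1, hX.2]
    ring
  have f_surj : Function.Surjective f := by
    intro X
    -- The coordinates of X along j and l are read off by pairing with the dual subspaces s(l) and
    -- j; the remainder is orthogonal to both.
    let Z : Dual ℝ l := g.form X ∘ₗ s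
    have hv : X - ι Z - s (Q X) ∈ V := by
      rw [mem_V]
      refine ⟨fun W => ?_, fun M => ?_⟩
      · rw [map_sub, map_sub, hιι, hιs, hQ]
        ring
      · rw [map_sub, map_sub, hsι, hss, g.form_swap]
        simp [Z]
    exact ⟨(Z, ⟨_, hv⟩, Q X), by rw [hf]; dsimp only; abel⟩
  have V_sep : (g.form.restrict V).SeparatingLeft := by
    rintro ⟨v, hv⟩ h
    refine Subtype.ext (g.nondegenerate.1 v fun X => ?_)
    obtain ⟨Y, rfl⟩ := f_surj X
    have h1 := f_form (0, ⟨v, hv⟩, 0) Y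
    have h2 : g.form v Y.2.1 = 0 := h Y.2.1
    rw [hf] at h1
    simpa [h2] using h1
  have V_nondeg : (g.form.restrict V).Nondegenerate :=
    ⟨V_sep, fun v h => V_sep v fun w => by
      have h1 : g.form w v = 0 := h w
      change g.form v w = 0
      rw [g.form_swap, h1, neg_zero]⟩
  have f_inj : Function.Injective f := by
    rw [← LinearMap.ker_eq_bot, LinearMap.ker_eq_bot']
    intro X hX
    have h : ∀ Y : Dual ℝ l × V × l, X.1 Y.2.2 + g.form X.2.1 Y.2.1 - Y.1 X.2.2 = 0 := fun Y => by
      rw [← f_form, hX, map_zero, LinearMap.zero_apply]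
    refine Prod.ext (LinearMap.ext fun L => ?_) (Prod.ext (V_sep _ fun v => ?_) ?_)
    · simpa using h (0, 0, L)
    · simpa using h (0, v, 0)
    · rw [Prod.snd_zero, Prod.snd_zero, ← Module.forall_dual_apply_eq_zero_iff ℝ]
      intro Z
      simpa using h (Z, 0, 0)
  refine ⟨V, LinearEquiv.ofBijective f ⟨f_inj, f_surj⟩, fun X => ?_, V_nondeg, f_form⟩
  change f X ∈ j ↔ _
  constructor
  · intro hX
    have h : f X = f (i.symm ⟨_, hX⟩, 0, 0) := by
      rw [hf (_, 0, 0)]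
      simp [ι]
    exact congrArg Prod.snd (f_inj h)
  · obtain ⟨Z, W⟩ := X
    rintro rfl
    rw [hf]
    simpa using ι_mem Z

/-! ### The reduced Lie algebra on the middle summand. -/

section Reduction

variable {g : SymplecticLieAlgebra.{w}} {l : Type v} [AddCommGroup l] [Module ℝ l]
  {V : Type u} [AddCommGroup V] [Module ℝ V]

theorem form_lie_eq_zero {Z : g} (hZ : ∀ Y : g, ⁅Z, Y⁆ = 0) (X Y : g) : g.form Z ⁅X, Y⁆ = 0 := by
  have h := g.form_cyclic X Y Z
  rw [← lie_skew Y Z, hZ, hZ] at h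
  rw [g.form_swap]
  simpa using h

/-- Brackets are orthogonal to the central subspace j, and pairing with j reads off the
l-coordinate. -/
theorem symm_lie_snd_snd {ω : LinearMap.BilinForm ℝ V} (e : (Dual ℝ l × V × l) ≃ₗ[ℝ] g)
    (hf : ∀ X Y, g.form (e X) (e Y) = X.1 Y.2.2 + ω X.2.1 Y.2.1 - Y.1 X.2.2)
    (hc : ∀ Z (Y : g), ⁅e (Z, 0, 0), Y⁆ = 0) (X Y : g) : (e.symm ⁅X, Y⁆).2.2 = 0 := by
  rw [← Module.forall_dual_apply_eq_zero_iff ℝ]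
  intro Z
  have h := form_lie_eq_zero (hc Z) X Y
  rw [← e.apply_symm_apply ⁅X, Y⁆, hf] at h
  simpa using h

theorem lie_middle (e : (Dual ℝ l × V × l) ≃ₗ[ℝ] g) (hc : ∀ Z (Y : g), ⁅e (Z, 0, 0), Y⁆ = 0) {X : g}
    (hX : (e.symm X).2.2 = 0) (Y : g) : ⁅e (0, (e.symm X).2.1, 0), Y⁆ = ⁅X, Y⁆ := by
  have h : X = e ((e.symm X).1, 0, 0) + e (0, (e.symm X).2.1, 0) := by
    rw [← map_add, ← e.symm_apply_eq]
    exact Prod.ext (by simp) (Prod.ext (by simp) (by simp [hX]))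
  conv_rhs => rw [h, add_lie, hc, zero_add]

/-- The symplectic Lie algebra `V ≅ j^⊥ / j` obtained from a splitting `g = j ⊕ V ⊕ l` with
`j` central. -/
def reduction [FiniteDimensional ℝ V] (ω : LinearMap.BilinForm ℝ V) (halt : ω.IsAlt) (hnd : ω.Nondegenerate)
    (e : (Dual ℝ l × V × l) ≃ₗ[ℝ] g)
    (hf : ∀ X Y, g.form (e X) (e Y) = X.1 Y.2.2 + ω X.2.1 Y.2.1 - Y.1 X.2.2)
    (hc : ∀ Z (Y : g), ⁅e (Z, 0, 0), Y⁆ = 0) : SymplecticLieAlgebra.{u} :=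
  let inc : V →ₗ[ℝ] g :=
    e.toLinearMap ∘ₗ LinearMap.inr ℝ (Dual ℝ l) (V × l) ∘ₗ LinearMap.inl ℝ V l
  let pr : g →ₗ[ℝ] V :=
    LinearMap.fst ℝ V l ∘ₗ LinearMap.snd ℝ (Dual ℝ l) (V × l) ∘ₗ e.symm.toLinearMap
  -- Projecting an inner bracket to V discards only a central j-component, so the Jacobi identity is
  -- inherited from g.
  have lie_pr : ∀ A B C, ⁅inc (pr ⁅inc A, inc B⁆), inc C⁆ = ⁅⁅inc A, inc B⁆, inc C⁆ :=
    fun _ _ _ => lie_middle e hc (symm_lie_snd_snd e hf hc _ _) _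
  have pr_lie : ∀ A B C, ⁅inc C, inc (pr ⁅inc A, inc B⁆)⁆ = ⁅inc C, ⁅inc A, inc B⁆⁆ :=
    fun A B C => by rw [← lie_skew, lie_pr, lie_skew]
  have form_pr : ∀ A B C, ω (pr ⁅inc A, inc B⁆) C = g.form ⁅inc A, inc B⁆ (inc C) :=
    fun A B C => by
      have h := hf (e.symm ⁅inc A, inc B⁆) (0, C, 0)
      rw [e.apply_symm_apply] at h
      change g.form ⁅inc A, inc B⁆ (inc C) = _ at h
      rw [h]
      simp [pr]
  letI ring : LieRing V :=
    { bracket := fun A B => pr ⁅inc A, inc B⁆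
      add_lie := fun A B C => by
        change pr _ = pr _ + pr _
        rw [map_add, add_lie, map_add]
      lie_add := fun A B C => by
        change pr _ = pr _ + pr _
        rw [map_add, lie_add, map_add]
      lie_self := fun A => by
        rw [lie_self, map_zero]
      leibniz_lie := fun A B C => by
        change pr ⁅inc A, inc (pr ⁅inc B, inc C⁆)⁆ =
          pr ⁅inc (pr ⁅inc A, inc B⁆), inc C⁆ + pr ⁅inc B, inc (pr ⁅inc A, inc C⁆)⁆
        rw [pr_lie, lie_pr, pr_lie, leibniz_lie, map_add] }
  letI alg : LieAlgebra ℝ V :=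
    { lie_smul := fun c A B => by
        change pr _ = c • pr _
        rw [map_smul, lie_smul, map_smul] }
  { carrier := V
    lieRing := ring
    lieAlgebra := alg
    finiteDimensional := inferInstance
    form := ω
    isAlt := halt
    nondegenerate := hnd
    closed := fun A B C => by
      change -ω (pr ⁅inc A, inc B⁆) C + ω (pr ⁅inc A, inc C⁆) B - ω (pr ⁅inc B, inc C⁆) A = 0
      rw [form_pr, form_pr, form_pr, g.closed] }

end Reduction

/-! ### Extraction of the cocycle -/

section Extraction

variable {l : Type v} [AddCommGroup l] [Module ℝ l] {a : SymplecticLieAlgebra.{u}}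

/-- A triple is a cocycle if its bracket satisfies the Jacobi identity and the form is closed. -/
theorem Triple.isCocycle_of_bracket (x : Triple l a)
    (hj : ∀ X Y Z, x.bracket X (x.bracket Y Z) =
      x.bracket (x.bracket X Y) Z + x.bracket Y (x.bracket X Z))
    (hcl : ∀ X Y Z, -modelForm l a (x.bracket X Y) Z + modelForm l a (x.bracket X Z) Y
      - modelForm l a (x.bracket Y Z) X = 0) : x.IsCocycle where
  -- Every condition but the last is a component of the Jacobi identity on elements of l and a. The
  -- cyclic condition on ε is closedness on l.
  derivation L A B := by
    simpa [bracket] using congrArg (fun X => X.2.1) (hj (0, 0, L) (0, A, 0) (0, B, 0))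
  curvature L M := LinearMap.ext fun A => by
    have h := congrArg (fun X => X.2.1) (hj (0, 0, L) (0, 0, M) (0, A, 0))
    simp only [bracket, map_zero, LinearMap.zero_apply, zero_add, add_zero, sub_zero, zero_lie,
      lie_zero, Prod.snd_add, Prod.fst_add] at h
    simp [h]
  dξ_α L M N := by
    have h := congrArg (fun X => X.2.1) (hj (0, 0, L) (0, 0, M) (0, 0, N))
    simp only [bracket, map_zero, LinearMap.zero_apply, zero_add, add_zero, sub_zero, zero_lie,
      lie_zero, zero_sub, Prod.snd_add, Prod.fst_add] at h
    rw [h]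
    abel
  β_ξ L A B := by
    have h := congrArg (fun X => X.1) (hj (0, 0, L) (0, A, 0) (0, B, 0))
    simp only [bracket, map_zero, LinearMap.zero_apply, zero_add, add_zero, sub_zero, zero_lie,
      Prod.fst_add] at h
    exact h.symm
  dξ_γ L M := LinearMap.ext fun A => by
    have h := congrArg (fun X => X.1) (hj (0, 0, L) (0, 0, M) (0, A, 0))
    simp only [bracket, map_zero, LinearMap.zero_apply, zero_add, add_zero, sub_zero, zero_lie,
      lie_zero, Prod.fst_add] at h
    simp [h]
  γ_α L M N := by
    have h := congrArg (fun X => X.1) (hj (0, 0, L) (0, 0, M) (0, 0, N))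
    simp only [bracket, map_zero, LinearMap.zero_apply, zero_add, add_zero, sub_zero, zero_lie,
      lie_zero, zero_sub, Prod.fst_add] at h
    rw [h]
    abel
  ε_cyclic L M N := by
    have h := hcl (0, 0, L) (0, 0, M) (0, 0, N)
    simp only [bracket, modelForm_apply, map_zero, zero_add, add_zero,
      sub_zero] at h
    rw [x.ε_swap N L, LinearMap.neg_apply]
    linarith

variable {g : SymplecticLieAlgebra.{max v u}}

/-- The bracket of `g` transported to `l^* ⊕ a ⊕ l`. -/
def transportedBracket (e : (Dual ℝ l × a × l) ≃ₗ[ℝ] g) :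
    (Dual ℝ l × a × l) →ₗ[ℝ] (Dual ℝ l × a × l) →ₗ[ℝ] (Dual ℝ l × a × l) :=
  ((LieModule.toEnd ℝ g g : g →ₗ[ℝ] End ℝ g).compl₁₂ e.toLinearMap e.toLinearMap).compr₂
    e.symm.toLinearMap

theorem transportedBracket_apply (e : (Dual ℝ l × a × l) ≃ₗ[ℝ] g) (X Y : Dual ℝ l × a × l) :
    transportedBracket e X Y = e.symm ⁅e X, e Y⁆ := rfl

/-- The triple given by the components of the bracket of `g`. -/
def tripleOfEquiv (e : (Dual ℝ l × a × l) ≃ₗ[ℝ] g) : Triple l a where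
  γ := ((transportedBracket e).compl₁₂ (LinearMap.inr ℝ _ _ ∘ₗ LinearMap.inr ℝ _ _)
    (LinearMap.inr ℝ _ _ ∘ₗ LinearMap.inl ℝ _ _)).compr₂ (LinearMap.fst ℝ _ _)
  ε := ((transportedBracket e).compl₁₂ (LinearMap.inr ℝ _ _ ∘ₗ LinearMap.inr ℝ _ _)
    (LinearMap.inr ℝ _ _ ∘ₗ LinearMap.inr ℝ _ _)).compr₂ (LinearMap.fst ℝ _ _)
  ε_alt L := by simp [transportedBracket_apply]
  ξ := ((transportedBracket e).compl₁₂ (LinearMap.inr ℝ _ _ ∘ₗ LinearMap.inr ℝ _ _)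
    (LinearMap.inr ℝ _ _ ∘ₗ LinearMap.inl ℝ _ _)).compr₂
      (LinearMap.fst ℝ _ _ ∘ₗ LinearMap.snd ℝ _ _)

theorem tripleOfEquiv_γ (e : (Dual ℝ l × a × l) ≃ₗ[ℝ] g) (L : l) (A : a) :
    (tripleOfEquiv e).γ L A = (transportedBracket e (0, 0, L) (0, A, 0)).1 := rfl

theorem tripleOfEquiv_ε (e : (Dual ℝ l × a × l) ≃ₗ[ℝ] g) (L M : l) :
    (tripleOfEquiv e).ε L M = (transportedBracket e (0, 0, L) (0, 0, M)).1 := rfl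

theorem tripleOfEquiv_ξ (e : (Dual ℝ l × a × l) ≃ₗ[ℝ] g) (L : l) (A : a) :
    (tripleOfEquiv e).ξ L A = (transportedBracket e (0, 0, L) (0, A, 0)).2.1 := rfl

/-- The triple records only some components of the bracket; α and β are recovered from the others by
closedness. Centrality of l^* and the absence of l-components account for the rest, and `hb`
supplies the bracket of a. -/
theorem tripleOfEquiv_bracket (e : (Dual ℝ l × a × l) ≃ₗ[ℝ] g)
    (hf : ∀ X Y, g.form (e X) (e Y) = modelForm l a X Y)
    (hc : ∀ Z (Y : g), ⁅e (Z, 0, 0), Y⁆ = 0)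
    (hb : ∀ A B, (e.symm ⁅e (0, A, 0), e (0, B, 0)⁆).2.1 = ⁅A, B⁆) (X Y : Dual ℝ l × a × l) :
    (tripleOfEquiv e).bracket X Y = e.symm ⁅e X, e Y⁆ := by
  set x := tripleOfEquiv e with hx
  set b := transportedBracket e with hbe
  have b_swap : ∀ X Y, b X Y = -b Y X := fun X Y => by
    rw [hbe, transportedBracket_apply, transportedBracket_apply, ← lie_skew, map_neg]
  have b_top : ∀ X Y, (b X Y).2.2 = 0 := fun X Y => symm_lie_snd_snd (ω := a.form) e hf hc _ _
  have b_closed : ∀ X Y Z, -modelForm l a (b X Y) Z + modelForm l a (b X Z) Y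
      - modelForm l a (b Y Z) X = 0 := fun X Y Z => by
    simp only [← hf, hbe, transportedBracket_apply, e.apply_symm_apply]
    exact g.closed _ _ _
  have b_dual : ∀ Z Y, b (Z, 0, 0) Y = 0 := fun Z Y => by
    rw [hbe, transportedBracket_apply, hc, map_zero]
  have b_dual' : ∀ Z Y, b Y (Z, 0, 0) = 0 := fun Z Y => by rw [b_swap, b_dual, neg_zero]
  have b_α : ∀ L M, (b (0, 0, L) (0, 0, M)).2.1 = x.α L M := fun L M => by
    rw [← sub_eq_zero]
    refine a.nondegenerate.1 _ fun A => ?_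
    have h := b_closed (0, 0, L) (0, 0, M) (0, A, 0)
    simp only [modelForm_apply, b_top, map_zero, zero_add, add_zero,
      sub_zero] at h
    rw [map_sub, LinearMap.sub_apply, Triple.form_α, hx, tripleOfEquiv_γ, tripleOfEquiv_γ]
    linarith
  have b_β : ∀ A B, (b (0, A, 0) (0, B, 0)).1 = x.β A B := fun A B => LinearMap.ext fun L => by
    have h := b_closed (0, A, 0) (0, B, 0) (0, 0, L)
    rw [b_swap _ (0, 0, L), b_swap _ (0, 0, L), map_neg, map_neg, LinearMap.neg_apply,
      LinearMap.neg_apply] at h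
    simp only [modelForm_apply, b_top, map_zero, zero_add, add_zero,
      sub_zero] at h
    rw [Triple.β_apply, hx, tripleOfEquiv_ξ, tripleOfEquiv_ξ, a.form_swap A]
    linarith
  have decomp : ∀ X : Dual ℝ l × a × l, X = (X.1, 0, 0) + (0, X.2.1, 0) + (0, 0, X.2.2) :=
    fun X => by simp
  change _ = b X Y
  conv_rhs => rw [decomp X, decomp Y]
  simp only [map_add, LinearMap.add_apply, b_dual, b_dual', zero_add]
  rw [b_swap (0, X.2.1, 0) (0, 0, Y.2.2)]
  refine Prod.ext ?_ (Prod.ext ?_ ?_)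
  · simp only [Triple.bracket, Prod.fst_add, Prod.fst_neg, b_β]
    rw [hx, tripleOfEquiv_γ, tripleOfEquiv_γ, tripleOfEquiv_ε]
    abel
  · simp only [Triple.bracket, Prod.fst_add, Prod.fst_neg, Prod.snd_add, Prod.snd_neg, b_α]
    rw [hx, tripleOfEquiv_ξ, tripleOfEquiv_ξ, ← hb]
    rw [← transportedBracket_apply]
    abel
  · simp [Triple.bracket, b_top]

theorem isCocycle_tripleOfEquiv (e : (Dual ℝ l × a × l) ≃ₗ[ℝ] g)
    (hf : ∀ X Y, g.form (e X) (e Y) = modelForm l a X Y)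
    (hc : ∀ Z (Y : g), ⁅e (Z, 0, 0), Y⁆ = 0)
    (hb : ∀ A B, (e.symm ⁅e (0, A, 0), e (0, B, 0)⁆).2.1 = ⁅A, B⁆) :
    (tripleOfEquiv e).IsCocycle := by
  refine Triple.isCocycle_of_bracket _ (fun X Y Z => ?_) fun X Y Z => ?_
  · simp only [tripleOfEquiv_bracket e hf hc hb, e.apply_symm_apply]
    rw [leibniz_lie, map_add]
  · simp only [tripleOfEquiv_bracket e hf hc hb, ← hf, e.apply_symm_apply]
    exact g.closed _ _ _

end Extraction

/-! ### The classification -/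

section Extraction

variable {l : Type v} [AddCommGroup l] [Module ℝ l] [FiniteDimensional ℝ l]
  {a : SymplecticLieAlgebra.{u}} {g : SymplecticLieAlgebra.{max v u}}

/-- `g` is isomorphic to the standard model of the triple given by the components of its
bracket. -/
def isoTripleOfEquiv (e : (Dual ℝ l × a × l) ≃ₗ[ℝ] g)
    (hf : ∀ X Y, g.form (e X) (e Y) = modelForm l a X Y)
    (hc : ∀ Z (Y : g), ⁅e (Z, 0, 0), Y⁆ = 0)
    (hb : ∀ A B, (e.symm ⁅e (0, A, 0), e (0, B, 0)⁆).2.1 = ⁅A, B⁆) :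
    SymplecticIso (standardModel (tripleOfEquiv e) (isCocycle_tripleOfEquiv e hf hc hb)) g :=
  isoOfModelEquiv _ _ g e
    (fun X Y => by rw [tripleOfEquiv_bracket e hf hc hb, e.apply_symm_apply]) hf

/-- Since l^* corresponds to the whole central radical of g, the model has radical l^*, which makes
the cocycle balanced. Nilpotency of g transfers to the isomorphic model and from there to ξ and a.
-/
theorem isNilpotentCocycle_tripleOfEquiv (e : (Dual ℝ l × a × l) ≃ₗ[ℝ] g)
    (hf : ∀ X Y, g.form (e X) (e Y) = modelForm l a X Y)
    (hr : ∀ X, e X ∈ centralRadical g ↔ X.2 = 0)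
    (hb : ∀ A B, (e.symm ⁅e (0, A, 0), e (0, B, 0)⁆).2.1 = ⁅A, B⁆)
    (hg : LieRing.IsNilpotent g) :
    (tripleOfEquiv e).IsNilpotentCocycle ∧ LieRing.IsNilpotent a := by
  have hc : ∀ Z (Y : g), ⁅e (Z, 0, 0), Y⁆ = 0 := fun Z => ((hr (Z, 0, 0)).2 rfl).1
  let φ := isoTripleOfEquiv e hf hc hb
  have hx := isCocycle_tripleOfEquiv e hf hc hb
  have hn : LieRing.IsNilpotent (standardModel (tripleOfEquiv e) hx) :=
    (LieEquiv.nilpotent_iff_equiv_nilpotent φ.toLieEquiv).2 hg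
  refine ⟨{ hx.isBalanced fun X => ?_ with nilpotent := Triple.exists_prod_eq_zero hn },
    isNilpotent_of_standardModel hn⟩
  rw [← hr]
  refine ⟨fun h => φ.mem_centralRadical (((tripleOfEquiv e).mem_centralRadical hx X).2 h),
    fun h => ?_⟩
  have h1 := φ.symm.mem_centralRadical h
  have h2 : φ.symm.toLieEquiv (e X) = X := φ.toLieEquiv.symm_apply_apply X
  rw [h2] at h1
  exact h1

end Extraction

/-- Every non-abelian nilpotent symplectic Lie algebra is isomorphic to a standard model. -/
theorem exists_standardModel_iso (n : ℕ) (𝔄 : ℕ → Set SymplecticLieAlgebra.{u})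
    (h𝔄 : ∀ m ∈ Set.Icc 1 n, IsNilpotentRepresentatives (2 * n - 2 * m) (𝔄 (2 * n - 2 * m)))
    (g : SymplecticLieAlgebra.{u}) (hab : ¬ IsLieAbelian g) (hg : LieRing.IsNilpotent g)
    (hn : finrank ℝ g = 2 * n) :
    ∃ (m : Set.Icc 1 n) (a : 𝔄 (2 * n - 2 * m)) (x : Triple (Fin m → ℝ) a.1)
      (hx : x.IsNilpotentCocycle), Nonempty (SymplecticIso (standardModel x hx.toIsCocycle) g) := by
  obtain ⟨V, e, hr, hV, hf⟩ := exists_splitting g (centralRadical g) fun X hX Y hY => hX.2 Y hY.1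
  have hpos : 1 ≤ finrank ℝ (centralRadical g) := by
    rw [Submodule.one_le_finrank_iff]
    exact fun h => hab (isLieAbelian_of_centralRadical_eq_bot h)
  have hdim : finrank ℝ V + 2 * finrank ℝ (centralRadical g) = 2 * n := by
    rw [← hn, ← e.finrank_eq, finrank_prod, finrank_prod, Subspace.dual_finrank_eq,
      finrank_fin_fun]
    ring
  generalize finrank ℝ (centralRadical g) = m at e hr hf hpos hdim
  have hm : m ∈ Set.Icc 1 n := ⟨hpos, by omega⟩
  have hc : ∀ Z (Y : g), ⁅e (Z, 0, 0), Y⁆ = 0 := fun Z => ((hr (Z, 0, 0)).2 rfl).1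
  let b : SymplecticLieAlgebra.{u} :=
    reduction (g.form.restrict V) (fun v => g.isAlt v) hV e hf hc
  have hbd : finrank ℝ b = 2 * n - 2 * m := by
    change finrank ℝ V = _
    omega
  have hbn : LieRing.IsNilpotent b :=
    (isNilpotentCocycle_tripleOfEquiv (a := b) e hf hr (fun _ _ => rfl) hg).2
  obtain ⟨a, ⟨ha, ⟨U⟩⟩, -⟩ := (h𝔄 m hm).existsUnique b hbn hbd
  -- The reduction `b` is only isomorphic to the chosen representative `a`, so the middle coordinate
  -- is changed by U⁻¹.
  let e' : (Dual ℝ (Fin m → ℝ) × a × (Fin m → ℝ)) ≃ₗ[ℝ] g :=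
    ((LinearEquiv.refl ℝ _).prodCongr
      (U.toLieEquiv.symm.toLinearEquiv.prodCongr (LinearEquiv.refl ℝ _))).trans
        (show (Dual ℝ (Fin m → ℝ) × b × (Fin m → ℝ)) ≃ₗ[ℝ] g from e)
  have he' : ∀ X, e' X = e (X.1, U.toLieEquiv.symm X.2.1, X.2.2) := fun X => rfl
  have hf' : ∀ X Y, g.form (e' X) (e' Y) = modelForm _ a X Y := fun X Y => by
    rw [he', he', hf, modelForm_apply, ← U.symm.map_form]
    rfl
  have hr' : ∀ X, e' X ∈ centralRadical g ↔ X.2 = 0 := fun X => by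
    rw [he', hr]
    exact ((U.toLieEquiv.symm.toLinearEquiv.prodCongr
      (LinearEquiv.refl ℝ (Fin m → ℝ))).map_eq_zero_iff (x := X.2))
  have hb' : ∀ A B, (e'.symm ⁅e' (0, A, 0), e' (0, B, 0)⁆).2.1 = ⁅A, B⁆ := fun A B => by
    change U.toLieEquiv ⁅U.toLieEquiv.symm A, U.toLieEquiv.symm B⁆ = _
    rw [LieEquiv.map_lie, LieEquiv.apply_symm_apply, LieEquiv.apply_symm_apply]
  exact ⟨⟨m, hm⟩, ⟨a, ha⟩, tripleOfEquiv e',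
    (isNilpotentCocycle_tripleOfEquiv e' hf' hr' hb' hg).1,
    ⟨isoTripleOfEquiv e' hf' (fun Z => ((hr' (Z, 0, 0)).2 rfl).1) hb'⟩⟩

/-- The model cannot be abelian: its central radical contains l^*, which is nonzero because m ≥ 1,
whereas that of an abelian algebra vanishes by non-degeneracy. -/
theorem standardModel_mem {n m : ℕ} (hm : m ∈ Set.Icc 1 n) {a : SymplecticLieAlgebra.{u}}
    (ha : LieRing.IsNilpotent a) (hd : finrank ℝ a = 2 * n - 2 * m)
    {x : Triple (Fin m → ℝ) a} (hx : x.IsNilpotentCocycle) :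
    (⟦standardModel x hx.toIsCocycle⟧ : IsoClass.{u}) ∈ nonabelianNilpotentClasses (2 * n) := by
  refine ⟨_, fun h => ?_, hx.isNilpotent_standardModel ha, ?_, rfl⟩
  · have h0 := centralRadical_eq_bot h
    have h1 : ∀ Z : Dual ℝ (Fin m → ℝ), Z = 0 := fun Z => by
      have h2 := (x.mem_centralRadical hx.toIsCocycle (Z, 0, 0)).2
        ((hx.toIsBalanced.isRadical_iff _).2 rfl)
      rw [h0] at h2
      have h3 : ((Z, 0, 0) : Dual ℝ (Fin m → ℝ) × a × (Fin m → ℝ)) = 0 := h2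
      exact congrArg Prod.fst h3
    have h3 := LinearMap.congr_fun (h1 (LinearMap.proj ⟨0, hm.1⟩)) fun _ => 1
    simp at h3
  · change finrank ℝ (Dual ℝ (Fin m → ℝ) × a × (Fin m → ℝ)) = _
    rw [finrank_prod, finrank_prod, Subspace.dual_finrank_eq, finrank_fin_fun, hd]
    have := hm.2
    omega

theorem NilpotentOrbits.exists_rep {l : Type v} [AddCommGroup l] [Module ℝ l]
    {a : SymplecticLieAlgebra.{u}} (q : NilpotentOrbits l a) :
    ∃ (x : Triple l a) (hx : x.IsNilpotentCocycle), x.orbit hx = q := by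
  induction q using Quotient.inductionOn with
  | h c =>
    obtain ⟨c, x, hx, rfl⟩ := c
    exact ⟨x, hx, rfl⟩

end

end SymplecticLie

/-! ### The bijection. -/

open SymplecticLie in
theorem mainTheorem2 (n : ℕ) (𝔄 : ℕ → Set SymplecticLieAlgebra.{u})
    (h𝔄 : ∀ m ∈ Set.Icc 1 n, IsNilpotentRepresentatives (2 * n - 2 * m) (𝔄 (2 * n - 2 * m))) :
    ∃ Φ : (Σ m : Set.Icc 1 n, Σ a : 𝔄 (2 * n - 2 * m), NilpotentOrbits (Fin m → ℝ) a.1) ≃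
        nonabelianNilpotentClasses.{u} (2 * n),
      ∀ (m : Set.Icc 1 n) (a : 𝔄 (2 * n - 2 * m)) (x : Triple (Fin m → ℝ) a.1)
        (hx : x.IsNilpotentCocycle),
        (Φ ⟨m, a, x.orbit hx⟩ : IsoClass.{u}) = ⟦standardModel x hx.toIsCocycle⟧ := by
  choose rep hrep rep_orbit using fun (m : Set.Icc 1 n) (a : 𝔄 (2 * n - 2 * m))
    (q : NilpotentOrbits (Fin m → ℝ) a.1) => q.exists_rep
  let F : (Σ m : Set.Icc 1 n, Σ a : 𝔄 (2 * n - 2 * m), NilpotentOrbits (Fin m → ℝ) a.1) →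
      nonabelianNilpotentClasses.{u} (2 * n) := fun q =>
    ⟨⟦standardModel _ (hrep q.1 q.2.1 q.2.2).toIsCocycle⟧, standardModel_mem q.1.2
      ((h𝔄 _ q.1.2).isNilpotent _ q.2.1.2) ((h𝔄 _ q.1.2).finrank_eq _ q.2.1.2) (hrep q.1 q.2.1 q.2.2)⟩
  -- This is well-definedness: the class of the model does not depend on the cocycle chosen in the
  -- orbit.
  have hF : ∀ (m : Set.Icc 1 n) (a : 𝔄 (2 * n - 2 * m)) (x : Triple (Fin m → ℝ) a.1)
      (hx : x.IsNilpotentCocycle),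
      (F ⟨m, a, x.orbit hx⟩ : IsoClass.{u}) = ⟦standardModel x hx.toIsCocycle⟧ :=
    fun m a x hx => Quotient.sound
      ((Triple.orbit_eq_iff (hrep m a (x.orbit hx)) hx).1 (rep_orbit m a (x.orbit hx)))
  refine ⟨Equiv.ofBijective F ⟨?_, ?_⟩, hF⟩
  · rintro ⟨m, a, q⟩ ⟨m', a', q'⟩ h
    obtain ⟨x, hx, rfl⟩ := q.exists_rep
    obtain ⟨x', hx', rfl⟩ := q'.exists_rep
    have h1 := congrArg Subtype.val h
    rw [hF, hF] at h1
    obtain ⟨φ⟩ := Quotient.exact h1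
    have e := FilteredIso.ofSymplecticIso hx.toIsBalanced hx'.toIsBalanced φ
    -- The induced map on l identifies the dimensions; the induced map on a then identifies the
    -- representatives by their uniqueness.
    obtain rfl : m = m' := Subtype.ext (by simpa using e.topEquiv.finrank_eq)
    obtain rfl : a = a' := by
      have ha := h𝔄 _ m.2
      exact Subtype.ext ((ha.existsUnique a.1 (ha.isNilpotent _ a.2) (ha.finrank_eq _ a.2)).unique
        ⟨a.2, ⟨.refl _⟩⟩ ⟨a'.2, ⟨e.middleIso⟩⟩)
    rw [(Triple.orbit_eq_iff hx hx').2 ⟨φ⟩]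
  · rintro ⟨_, g, hab, hg, hn, rfl⟩
    obtain ⟨m, a, x, hx, hφ⟩ := exists_standardModel_iso n 𝔄 h𝔄 g hab hg hn
    exact ⟨⟨m, a, x.orbit hx⟩, Subtype.ext ((hF m a x hx).trans (Quotient.sound hφ))⟩
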